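/- Let $\gamma\subset\hat{\mathbb C}=\mathbb C\cup\{\infty\}$ be a Jordan curve, let $\Omega$ be a connected component of $\hat{\mathbb C}\smallsetminus\gamma$, and let $f:\mathbb D\to\Omega$ be a conformal map from the unit disk onto $\Omega$. Put $$\|\mathcal S(f)\|_\infty=\sup_{\zeta\in\mathbb D}\frac{(1-|\zeta|^2)^2}{4}\,|\mathcal S(f)(\zeta)|,\qquad \mathcal S(f)=\frac{f'''}{f'}-\frac32\Big(\frac{f''}{f'}\Big)^2$$ (with $\mathcal S(f)=\mathcal S(1/f)$ at a pole of $f$), and $$t_0=\tfrac12\log\max\{1,\;2\|\mathcal S(f)\|_\infty-1\}.$$ Let $\rho_\Omega$ be the hyperbolic metric of $\Omega$, that is, the conformal metric with $f^*\rho_\Omega=\frac{4|d\zeta|^2}{(1-|\zeta|^2)^2}$. In the upper half-space model $\mathbb H^3=\{(Z,\xi): Z\in\mathbb C,\ \xi>0\}$, the Epstein map of a conformal metric $\rho=e^{\varphi}|dz|^2$ is $$\mathrm{Ep}_\rho(z)=\Big(z+\frac{2\varphi_{\bar z}e^{-\varphi}}{1+|\varphi_{\bar z}|^2e^{-\varphi}},\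 \frac{2e^{-\varphi/2}}{1+|\varphi_{\bar z}|^2e^{-\varphi}}\Big),$$ and at $z=\infty$ it is defined through the coordinate $1/z$ and the isometry of $\mathbb H^3$ that extends $z\mapsto 1/z$. For $t\in\mathbb R$ let $\Sigma_\Omega(t)\subset\mathbb H^3$ be the image of $\Omega$ under $\mathrm{Ep}_{e^{2t}\rho_\Omega}$. Let $M\subset\mathbb H^3$ be a minimal surface, that is, a properly immersed (for example, properly embedded) smooth surface without boundary whose mean curvature vanishes, and suppose that its ideal boundary $\partial_\infty M$ in $\hat{\mathbb C}=\partial_\infty\mathbb H^3$ is $\gamma$. Then exactly one connected component of $\mathbb H^3\smallsetminus M$ has $\Omega$ in its ideal boundary. Let $M_\Omega$ be the closure of this component. Then for every $t\ge t_0$, $$\Sigma_\Omega(t)\subset M_\Omega .$$ -/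

import Mathlib

open scoped Manifold ContDiff

noncomputable section

namespace EpsteinSurface

/-! ### The Riemann sphere -/

/-- The Riemann sphere `ℂ ∪ {∞}`. -/
abbrev Sphere : Type := OnePoint ℂ

/-- The affine coordinate `z` on the sphere minus `∞` (with the value `0` at `∞`). -/
def affineCoord : Sphere → ℂ
  | OnePoint.infty => 0
  | OnePoint.some z => z

/-- The involution `z ↦ 1/z` of the sphere. -/
def sphereInv : Sphere → Sphere
  | OnePoint.infty => ((0 : ℂ) : Sphere)
  | OnePoint.some z => if z = 0 then OnePoint.infty else ((z⁻¹ : ℂ) : Sphere)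

/-- The coordinate `1/z` on the sphere minus `0`, which vanishes at `∞`. -/
def coordAtInfty (p : Sphere) : ℂ := affineCoord (sphereInv p)

/-- A Jordan curve: the image of an injective continuous map of the circle. -/
def IsJordanCurve (γ : Set Sphere) : Prop :=
  ∃ c : Circle → Sphere, Continuous c ∧ Function.Injective c ∧ Set.range c = γ

/-- `U` is a connected component of the set `A`. -/
def IsComponentOf {X : Type*} [TopologicalSpace X] (U A : Set X) : Prop :=
  ∃ x ∈ A, U = connectedComponentIn A x

/-- The open unit disk. -/
def disk : Set ℂ := Metric.ball 0 1

/-- The expression of a sphere-valued function near `ζ` in a coordinate of the sphere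
around `f ζ`: the coordinate `z` if `f ζ ≠ ∞`, the coordinate `1/z` if `f ζ = ∞`. -/
def localExpr (f : ℂ → Sphere) (ζ : ℂ) : ℂ → ℂ :=
  open Classical in
  if f ζ = OnePoint.infty then fun w => coordAtInfty (f w) else fun w => affineCoord (f w)

/-- `f` restricts to a conformal map (biholomorphism) of the unit disk onto `Ω`. -/
structure IsConformalOnto (f : ℂ → Sphere) (Ω : Set Sphere) : Prop where
  continuousOn : ContinuousOn f disk
  holomorphic : ∀ ζ ∈ disk, DifferentiableAt ℂ (localExpr f ζ) ζ
  injOn : Set.InjOn f disk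
  image_eq : f '' disk = Ω

/-! ### The Schwarzian derivative and its norm -/

/-- `S(g) = g'''/g' - (3/2) (g''/g')²`. -/
def schwarzian (g : ℂ → ℂ) (ζ : ℂ) : ℂ :=
  iteratedDeriv 3 g ζ / deriv g ζ - 3 / 2 * (iteratedDeriv 2 g ζ / deriv g ζ) ^ 2

/-- The density `4 / (1 - |ζ|²)²` of the hyperbolic metric of the disk. -/
def diskDensity (ζ : ℂ) : ℝ := 4 / (1 - ‖ζ‖ ^ 2) ^ 2

/-- `‖S(f)‖_∞ = sup |S(f)(ζ)| / ρ_𝔻(ζ)` over the disk, in `[0, ∞]`. At a pole of `f` the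
Schwarzian is that of `1/f`, in agreement with the invariance `S(1/f) = S(f)`. -/
def schwarzianNorm (f : ℂ → Sphere) : ENNReal :=
  ⨆ ζ ∈ disk, ENNReal.ofReal (‖schwarzian (localExpr f ζ) ζ‖ / diskDensity ζ)

/-- `t₀ = (1/2) log max {1, 2 ‖S(f)‖_∞ - 1}`. -/
def thresholdTime (f : ℂ → Sphere) : EReal :=
  ((1 / 2 : ℝ) : EReal) * ENNReal.log (max 1 (2 * schwarzianNorm f - 1))

/-! ### Hyperbolic space -/

/-- Hyperbolic 3-space in the upper half-space model: pairs `(Z, ξ)` with `ξ > 0`. -/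
def H3 : Set (ℂ × ℝ) := {x | 0 < x.2}

/-- The Euclidean inner product of `ℂ × ℝ = ℝ³`. -/
def euclInner (v w : ℂ × ℝ) : ℝ := v.1.re * w.1.re + v.1.im * w.1.im + v.2 * w.2

/-- The hyperbolic metric `(|dZ|² + dξ²) / ξ²` at the point `x`. -/
def hypInner (x v w : ℂ × ℝ) : ℝ := euclInner v w / x.2 ^ 2

/-- The Christoffel symbols `Γ(v, w)` of the hyperbolic metric at the point `x`. -/
def christoffel (x v w : ℂ × ℝ) : ℂ × ℝ :=
  (1 / x.2) • (-(v.2 • w) - w.2 • v + ((0 : ℂ), euclInner v w))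

/-- The ideal boundary of a subset of `H3`: the points of the sphere `ℂ ∪ {∞}` that lie in
its closure in the compactification of the half-space, the sphere being embedded in
`(ℂ × ℝ) ∪ {∞}` by `z ↦ (z, 0)` and `∞ ↦ ∞`. -/
def idealBoundary (A : Set (ℂ × ℝ)) : Set Sphere :=
  {p | OnePoint.map (fun z : ℂ => (z, (0 : ℝ))) p ∈
    closure ((fun x : ℂ × ℝ => (x : OnePoint (ℂ × ℝ))) '' A)}

/-- The isometry of `H3` extending `z ↦ 1/z`. -/
def hypInv (x : ℂ × ℝ) : ℂ × ℝ :=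
  (((‖x.1‖ ^ 2 + x.2 ^ 2)⁻¹ : ℝ) • (starRingEnd ℂ x.1, x.2))

/-! ### Minimal surfaces -/

/-- The parameter plane. -/
abbrev Plane : Type := EuclideanSpace ℝ (Fin 2)

/-- The `i`-th partial derivative of a parametrization. -/
def partialD (u : Plane → ℂ × ℝ) (i : Fin 2) (a : Plane) : ℂ × ℝ :=
  fderiv ℝ u a (EuclideanSpace.single i 1)

/-- The covariant derivative `∇_i ∂_j u` along the parametrization `u`. -/
def covD (u : Plane → ℂ × ℝ) (i j : Fin 2) (a : Plane) : ℂ × ℝ :=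
  partialD (partialD u j) i a + christoffel (u a) (partialD u i a) (partialD u j a)

/-- The first fundamental form. -/
def firstForm (u : Plane → ℂ × ℝ) (i j : Fin 2) (a : Plane) : ℝ :=
  hypInner (u a) (partialD u i a) (partialD u j a)

/-- The second fundamental form with respect to the normal vector `n`. -/
def secondForm (u : Plane → ℂ × ℝ) (n : ℂ × ℝ) (i j : Fin 2) (a : Plane) : ℝ :=
  hypInner (u a) (covD u i j a) n

/-- The mean curvature `(1/2) tr (I⁻¹ II)` with respect to the normal vector `n`. -/
def meanCurvature (u : Plane → ℂ × ℝ) (n : ℂ × ℝ) (a : Plane) : ℝ :=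
  (firstForm u 1 1 a * secondForm u n 0 0 a - 2 * firstForm u 0 1 a * secondForm u n 0 1 a
      + firstForm u 0 0 a * secondForm u n 1 1 a) /
    (2 * (firstForm u 0 0 a * firstForm u 1 1 a - firstForm u 0 1 a ^ 2))

/-- `F : S → H3` is a proper smooth immersion of a surface without boundary whose mean
curvature vanishes identically. -/
structure IsProperMinimalImmersion {S : Type*} [TopologicalSpace S] [ChartedSpace Plane S]
    (F : S → ℂ × ℝ) : Prop where
  mem_H3 : ∀ s, F s ∈ H3
  smooth : ContMDiff (𝓡 2) 𝓘(ℝ, ℂ × ℝ) ∞ F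
  immersion : ∀ s, Function.Injective (mfderiv (𝓡 2) 𝓘(ℝ, ℂ × ℝ) F s)
  proper : ∀ K ⊆ H3, IsCompact K → IsCompact (F ⁻¹' K)
  minimal : ∀ s : S, ∀ n : ℂ × ℝ,
    (∀ i, hypInner (F s) (partialD (F ∘ (chartAt Plane s).symm) i (chartAt Plane s s)) n = 0) →
    meanCurvature (F ∘ (chartAt Plane s).symm) n (chartAt Plane s s) = 0

/-! ### Epstein surfaces

A conformal metric on an open subset of the sphere is written as `h σ`, where
`σ = 4 |dz|² / (1 + |z|²)²` is the round metric and `h` is a positive function. The round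
metric is invariant under `z ↦ 1/z`. -/

/-- The density with respect to `|dz|²` of the metric `h σ`. -/
def affineDensity (h : Sphere → ℝ) (z : ℂ) : ℝ := h (z : Sphere) * (4 / (1 + ‖z‖ ^ 2) ^ 2)

/-- The derivative `∂φ/∂z̄` of a real-valued function. -/
def dbar (φ : ℂ → ℝ) (z : ℂ) : ℂ :=
  ((fderiv ℝ φ z 1 : ℝ) + Complex.I * (fderiv ℝ φ z Complex.I : ℝ)) / 2

/-- The Epstein map of the metric `e^φ |dz|²` in a domain of the plane: the point `(Z, ξ)` with
`ξ = 2 e^{-φ/2} / (1 + |φ_z̄|² e^{-φ})` and `Z = z + 2 φ_z̄ e^{-φ} / (1 + |φ_z̄|² e^{-φ})`. -/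
def planarEpstein (φ : ℂ → ℝ) (z : ℂ) : ℂ × ℝ :=
  (z + 2 * dbar φ z * (Real.exp (-φ z) : ℝ) / (1 + ‖dbar φ z‖ ^ 2 * Real.exp (-φ z) : ℝ),
    2 * Real.exp (-φ z / 2) / (1 + ‖dbar φ z‖ ^ 2 * Real.exp (-φ z)))

/-- The Epstein map of the metric `h σ`. At `∞` it is computed in the coordinate `1/z` and
transported back by the isometry that extends `z ↦ 1/z`. -/
def epsteinMap (h : Sphere → ℝ) : Sphere → ℂ × ℝ
  | OnePoint.infty => hypInv (planarEpstein (fun z => Real.log (affineDensity (fun p => h (sphereInv p)) z)) 0)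
  | OnePoint.some z => planarEpstein (fun w => Real.log (affineDensity h w)) z

/-- The density of the pull-back `f^* σ` of the round metric by `f`. -/
def roundPullback (f : ℂ → Sphere) (ζ : ℂ) : ℝ :=
  ‖deriv (localExpr f ζ) ζ‖ ^ 2 * (4 / (1 + ‖localExpr f ζ ζ‖ ^ 2) ^ 2)

/-- The hyperbolic (Poincaré) metric of the image `Ω` of the conformal map `f` of the disk, as a
multiple of `σ`: the metric on `Ω` whose pull-back by `f` is the hyperbolic metric of the disk.
It does not depend on the choice of `f`. -/
def poincareMetric (f : ℂ → Sphere) (p : Sphere) : ℝ :=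
  diskDensity (Function.invFunOn f disk p) / roundPullback f (Function.invFunOn f disk p)

/-- The equidistant Epstein surface `Σ_Ω(t)`: the image of `Ω` under the Epstein map of
`e^{2t} ρ_Ω`, where `ρ_Ω` is the hyperbolic metric of `Ω = f(𝔻)`. -/
def equidistantSurface (f : ℂ → Sphere) (Ω : Set Sphere) (t : ℝ) : Set (ℂ × ℝ) :=
  epsteinMap (fun p => Real.exp (2 * t) * poincareMetric f p) '' Ω

end EpsteinSurface

end

open EpsteinSurface

/-!
The minimal surface `M` is compared with the whole family of horoballs of the hyperbolic metric
`ρ_Ω` at once. For `x = (Z, ξ)` in the half-space and `ζ` in the disk let `K(x, ζ)` be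
the kernel `horoKernel`, the square root of the density of the visual metric seen from `x` pulled
back by `f`. The open horoball at `f ζ` determined by `ρ_Ω` is the set where
`(1 - |ζ|²) K(x, ζ) > 1`, and the central claim (`horoKernel_mul_le_one`) is that `M` does not meet
any of these horoballs.

On a disk of radius `r < 1` the function `(r² - |ζ|²) K(x, ζ) / r` vanishes on the boundary, and for
`|ζ| ≤ r` the points `x` of `M` with `K(x, ζ) ≥ 1` stay in a compact part of the half-space, because
the compact set `f({|ζ| ≤ r})` misses the ideal boundary of `M`
(`exists_isCompact_of_not_mem_idealBoundary`). A supremum larger than `1` over `M` and the disk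
would therefore be attained. At such a maximum `(x, ζ)` the second variation is computed with the
help of a lift `(u₁, u₂)` of `f` to `ℂ²` with unimodular Wronskian, for which `1 / K = (|u₁ - Z u₂|²
+ ξ² |u₂|²) / ξ`, so that poles of `f` need no special treatment. Adding the second variations along
an orthonormal tangent frame of `M`, minimality eliminates the acceleration of the surface. Coupling
the frame vectors with displacements `h₁`, `h₂` of `ζ` that form a conformal frame, `h₁² + h₂² = 0`,
eliminates the second derivatives of the lift, which carry the Schwarzian derivative of `f`. What
remains is an inequality that forces the maximum to be at most `1`
(`one_le_sq_of_secondVariation_nonneg`, `le_one_of_isMax`). Letting `r` tend to `1` proves the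
claim.

The rest is soft. Every point of `Ω` has a connected end neighborhood in the half-space that misses
`M`, and as `Ω` is connected all of these lie in a single component `U`
(`existsUnique_component`). An open horoball at a point of `Ω` is convex, misses `M` and accumulates
at its base point, so it lies in `U`. The Epstein point of `e^{2t} ρ_Ω` lies on the horosphere of
`e^{2t} ρ_Ω`, and since the threshold time is nonnegative this horosphere is contained in the
closed horoball of `ρ_Ω`, hence in the closure of `U`.
-/

section

open Filter Topology Set

/-! ### Holomorphic preliminaries -/

theorem AnalyticAt.exists_pow_eventuallyEq {h : ℂ → ℂ} {z : ℂ} (hh : AnalyticAt ℂ h z)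
    (hz : h z ≠ 0) {n : ℕ} (hn : n ≠ 0) :
    ∃ k : ℂ → ℂ, AnalyticAt ℂ k z ∧ ∀ᶠ w in 𝓝 z, k w ^ n = h w := by
  obtain ⟨c, hc⟩ := IsAlgClosed.exists_pow_nat_eq (h z) (Nat.pos_of_ne_zero hn)
  refine ⟨fun w => c * (h w / h z) ^ ((n : ℂ)⁻¹), ?_, ?_⟩
  · refine analyticAt_const.mul ((hh.div analyticAt_const hz).cpow analyticAt_const ?_)
    simp [div_self hz]
  · refine Eventually.of_forall fun w => ?_
    rw [mul_pow, hc, Complex.cpow_nat_inv_pow _ hn, mul_div_cancel₀ _ hz]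

/-- A holomorphic function that is injective near a point has no critical point there: otherwise
it is locally `c + φ ^ n` with `n ≥ 2` and `φ` a local homeomorphism, and takes equal values at the
points where `φ` equals `v` and `μ v`, for `μ` a primitive `n`-th root of unity. -/
theorem AnalyticAt.deriv_ne_zero_of_injOn {g : ℂ → ℂ} {z : ℂ} (hg : AnalyticAt ℂ g z)
    {U : Set ℂ} (hU : U ∈ 𝓝 z) (hinj : InjOn g U) : deriv g z ≠ 0 := by
  intro hd
  have hG : AnalyticAt ℂ (fun w => g w - g z) z := hg.sub analyticAt_const
  have htop : analyticOrderAt (fun w => g w - g z) z ≠ ⊤ := by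
    intro h
    rw [analyticOrderAt_eq_top] at h
    have h1 : ∀ᶠ w in 𝓝[≠] z, w ∈ U ∧ g w - g z = 0 ∧ w ≠ z :=
      (show ∀ᶠ w in 𝓝[≠] z, w ∈ U from nhdsWithin_le_nhds hU).and
        ((h.filter_mono nhdsWithin_le_nhds).and self_mem_nhdsWithin)
    obtain ⟨w, hw, hw0, hwz⟩ := h1.exists
    exact hwz (hinj hw (mem_of_mem_nhds hU) (sub_eq_zero.mp hw0))
  obtain ⟨h, hh, hz, heq⟩ := (hG.analyticOrderAt_ne_top).mp htop
  set n := analyticOrderNatAt (fun w => g w - g z) z with hn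
  have hn0 : n ≠ 0 := by
    intro h0
    have := heq.self_of_nhds
    simp [h0] at this
    exact hz this.symm
  have hn1 : n ≠ 1 := by
    intro h1
    have e : g =ᶠ[𝓝 z] fun w => (w - z) * h w + g z := by
      filter_upwards [heq] with w hw
      rw [h1] at hw
      simp only [pow_one, smul_eq_mul] at hw
      linear_combination hw
    have hD : HasDerivAt (fun w => (w - z) * h w + g z) (1 * h z + (z - z) * deriv h z) z :=
      (((hasDerivAt_id z).sub_const z).mul hh.differentiableAt.hasDerivAt).add_const _
    rw [e.deriv_eq, hD.deriv] at hd
    simp at hd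
    exact hz hd
  obtain ⟨k, hk, hkn⟩ := hh.exists_pow_eventuallyEq hz hn0
  have hkz : k z ≠ 0 := by
    intro h0
    have := hkn.self_of_nhds
    rw [h0, zero_pow hn0] at this
    exact hz this.symm
  have hφ : AnalyticAt ℂ (fun w => (w - z) * k w) z :=
    (analyticAt_id.sub analyticAt_const).mul hk
  have hφd : HasStrictDerivAt (fun w => (w - z) * k w) (k z) z := by
    have h1 := hφ.hasStrictDerivAt
    have hD : HasDerivAt (fun w => (w - z) * k w) (1 * k z + (z - z) * deriv k z) z :=
      (((hasDerivAt_id z).sub_const z).mul hk.differentiableAt.hasDerivAt)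
    rw [hD.deriv] at h1
    simpa using h1
  have hmap := hφd.map_nhds_eq hkz
  simp only [sub_self, zero_mul] at hmap
  have hgood : ∀ᶠ w in 𝓝 z, w ∈ U ∧ g w = ((w - z) * k w) ^ n + g z := by
    filter_upwards [hU, heq, hkn] with w hw h1 h2
    refine ⟨hw, ?_⟩
    rw [smul_eq_mul, ← h2] at h1
    rw [mul_pow]; linear_combination h1
  have himg : ∀ᶠ v in 𝓝 (0 : ℂ), ∃ w, (w ∈ U ∧ g w = ((w - z) * k w) ^ n + g z) ∧
      (w - z) * k w = v := by
    rw [← hmap]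
    exact Filter.mem_map.mpr (hgood.mono fun w hw => ⟨w, hw, rfl⟩)
  have hμ := Complex.isPrimitiveRoot_exp n hn0
  set μ := Complex.exp (2 * Real.pi * Complex.I / n)
  have hμ1 : μ ≠ 1 := hμ.ne_one (by omega)
  have hmul : Tendsto (fun v : ℂ => μ * v) (𝓝 0) (𝓝 0) := by
    have : Continuous fun v : ℂ => μ * v := by fun_prop
    simpa using this.tendsto 0
  have hev : ∀ᶠ v in 𝓝[≠] (0 : ℂ), (∃ w, (w ∈ U ∧ g w = ((w - z) * k w) ^ n + g z) ∧
      (w - z) * k w = v) ∧ (∃ w, (w ∈ U ∧ g w = ((w - z) * k w) ^ n + g z) ∧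
      (w - z) * k w = μ * v) ∧ v ≠ 0 :=
    (himg.filter_mono nhdsWithin_le_nhds).and
      (((hmul.eventually himg).filter_mono nhdsWithin_le_nhds).and self_mem_nhdsWithin)
  obtain ⟨v, ⟨w1, ⟨hw1, hg1⟩, he1⟩, ⟨w2, ⟨hw2, hg2⟩, he2⟩, hv⟩ := hev.exists
  have : w1 = w2 := by
    refine hinj hw1 hw2 ?_
    rw [hg1, hg2, he1, he2, mul_pow, hμ.pow_eq_one, one_mul]
  rw [this, he2] at he1
  exact hμ1 (mul_right_cancel₀ hv (he1.trans (one_mul v).symm))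

/-- Homogeneous coordinates `[g k : k]` of a locally injective holomorphic function `g`, normalized
so that `k² g'` is constant of modulus `1`, that is, so that the Wronskian has modulus `1`. -/
theorem AnalyticAt.exists_normalized_lift {g : ℂ → ℂ} {z : ℂ} (hg : AnalyticAt ℂ g z)
    (hd : deriv g z ≠ 0) :
    ∃ k : ℂ → ℂ, AnalyticAt ℂ k z ∧ (∀ᶠ w in 𝓝 z, ‖k w‖ ^ 2 * ‖deriv g w‖ = 1) ∧
      ‖g z * k z * deriv k z - deriv (fun w => g w * k w) z * k z‖ = 1 := by
  obtain ⟨k, hk, hkn⟩ := (hg.deriv.inv hd).exists_pow_eventuallyEq (inv_ne_zero hd) two_ne_zero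
  have h0 : ∀ᶠ w in 𝓝 z, deriv g w ≠ 0 := hg.deriv.continuousAt.eventually_ne hd
  refine ⟨k, hk, ?_, ?_⟩
  · filter_upwards [hkn, h0] with w hw hw0
    rw [← norm_pow, hw, ← norm_mul, Pi.inv_apply, inv_mul_cancel₀ hw0, norm_one]
  · have hD : HasDerivAt (fun w => g w * k w) (deriv g z * k z + g z * deriv k z) z :=
      hg.differentiableAt.hasDerivAt.mul hk.differentiableAt.hasDerivAt
    rw [hD.deriv]
    have := hkn.self_of_nhds
    have e : g z * k z * deriv k z - (deriv g z * k z + g z * deriv k z) * k z = -1 := by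
      rw [Pi.inv_apply] at this
      calc _ = - (deriv g z * k z ^ 2) := by ring
        _ = -1 := by rw [this, mul_inv_cancel₀ hd]
    rw [e]; simp

end

namespace EpsteinSurface

open Filter Topology Set ComplexConjugate

/-! ### Conformal maps into the sphere -/

theorem affineCoord_coe (z : ℂ) : affineCoord (z : Sphere) = z := rfl

/-- This includes `z = 0`, where both sides have the junk value `0`. -/
theorem coordAtInfty_coe (z : ℂ) : coordAtInfty (z : Sphere) = z⁻¹ := by
  change affineCoord (if z = 0 then OnePoint.infty else ((z⁻¹ : ℂ) : Sphere)) = z⁻¹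
  split_ifs with h
  · rw [h, inv_zero]; rfl
  · rfl

theorem coordAtInfty_infty : coordAtInfty OnePoint.infty = 0 := rfl

theorem eq_coe_affineCoord {p : Sphere} (hp : p ≠ OnePoint.infty) :
    p = ((affineCoord p : ℂ) : Sphere) := by
  induction p using OnePoint.rec with
  | infty => exact absurd rfl hp
  | coe z => rfl

theorem coordAtInfty_eq_inv {p : Sphere} (hp : p ≠ OnePoint.infty) :
    coordAtInfty p = (affineCoord p)⁻¹ := by
  conv_lhs => rw [eq_coe_affineCoord hp]
  exact coordAtInfty_coe _

theorem isOpen_disk : IsOpen disk := Metric.isOpen_ball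

theorem disk_mem_nhds {ζ : ℂ} (hζ : ζ ∈ disk) : disk ∈ 𝓝 ζ := isOpen_disk.mem_nhds hζ

section

variable {f : ℂ → Sphere} {Ω : Set Sphere} {ζ : ℂ}

theorem localExpr_of_eq_infty (h : f ζ = OnePoint.infty) :
    localExpr f ζ = fun w => coordAtInfty (f w) := by simp [localExpr, h]

theorem localExpr_of_ne_infty (h : f ζ ≠ OnePoint.infty) :
    localExpr f ζ = fun w => affineCoord (f w) := by simp [localExpr, h]

namespace IsConformalOnto

theorem eventually_ne (hf : IsConformalOnto f Ω) (hζ : ζ ∈ disk) {p : Sphere} (h : f ζ ≠ p) :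
    ∀ᶠ w in 𝓝 ζ, f w ≠ p :=
  (hf.continuousOn.continuousAt (disk_mem_nhds hζ)).eventually_ne h

theorem analyticAt_affineCoord (hf : IsConformalOnto f Ω) (hζ : ζ ∈ disk)
    (h : f ζ ≠ OnePoint.infty) : AnalyticAt ℂ (fun w => affineCoord (f w)) ζ := by
  rw [Complex.analyticAt_iff_eventually_differentiableAt]
  filter_upwards [hf.eventually_ne hζ h, disk_mem_nhds hζ] with w hw hwd
  simpa [localExpr_of_ne_infty hw] using hf.holomorphic w hwd

theorem eventually_ne_infty (hf : IsConformalOnto f Ω) (hζ : ζ ∈ disk)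
    (h : f ζ = OnePoint.infty) : ∀ᶠ w in 𝓝[≠] ζ, w ∈ disk ∧ f w ≠ OnePoint.infty := by
  filter_upwards [nhdsWithin_le_nhds (disk_mem_nhds hζ), self_mem_nhdsWithin] with w hw hne
  exact ⟨hw, fun h' => hne (hf.injOn hw hζ (h'.trans h.symm))⟩

theorem eventually_affineCoord_ne_zero (hf : IsConformalOnto f Ω) (hζ : ζ ∈ disk)
    (h : f ζ = OnePoint.infty) :
    ∀ᶠ w in 𝓝 ζ, f w ≠ OnePoint.infty → affineCoord (f w) ≠ 0 := by
  have h0 : f ζ ≠ ((0 : ℂ) : Sphere) := by rw [h]; exact OnePoint.infty_ne_coe 0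
  filter_upwards [hf.eventually_ne hζ h0] with w hw hw1 hw2
  exact hw ((eq_coe_affineCoord hw1).trans (by rw [hw2]))

theorem analyticAt_coordAtInfty (hf : IsConformalOnto f Ω) (hζ : ζ ∈ disk)
    (h : f ζ = OnePoint.infty) : AnalyticAt ℂ (fun w => coordAtInfty (f w)) ζ := by
  rw [Complex.analyticAt_iff_eventually_differentiableAt]
  have h1 := (eventually_nhdsWithin_iff.mp (hf.eventually_ne_infty hζ h))
  filter_upwards [h1, hf.eventually_affineCoord_ne_zero hζ h] with w hw hw0
  rcases eq_or_ne w ζ with rfl | hne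
  · simpa [localExpr_of_eq_infty h] using hf.holomorphic w hζ
  · obtain ⟨hwd, hwi⟩ := hw hne
    have hd := (hf.analyticAt_affineCoord hwd hwi).differentiableAt.inv (hw0 hwi)
    refine hd.congr_of_eventuallyEq ?_
    filter_upwards [hf.eventually_ne hwd hwi] with v hv
    exact coordAtInfty_eq_inv hv

theorem deriv_affineCoord_ne_zero (hf : IsConformalOnto f Ω) (hζ : ζ ∈ disk)
    (h : f ζ ≠ OnePoint.infty) : deriv (fun w => affineCoord (f w)) ζ ≠ 0 := by
  refine (hf.analyticAt_affineCoord hζ h).deriv_ne_zero_of_injOn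
    (inter_mem (disk_mem_nhds hζ) (hf.eventually_ne hζ h)) ?_
  rintro v ⟨hv, hvi⟩ w ⟨hw, hwi⟩ e
  refine hf.injOn hv hw ?_
  rw [eq_coe_affineCoord hvi, eq_coe_affineCoord hwi]
  exact congrArg _ e

theorem deriv_coordAtInfty_ne_zero (hf : IsConformalOnto f Ω) (hζ : ζ ∈ disk)
    (h : f ζ = OnePoint.infty) : deriv (fun w => coordAtInfty (f w)) ζ ≠ 0 := by
  refine (hf.analyticAt_coordAtInfty hζ h).deriv_ne_zero_of_injOn
    (inter_mem (disk_mem_nhds hζ) (hf.eventually_affineCoord_ne_zero hζ h)) ?_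
  rintro v ⟨hv, hvi⟩ w ⟨hw, hwi⟩ e
  refine hf.injOn hv hw ?_
  simp only [mem_ofPred_eq] at hvi hwi
  by_cases hv' : f v = OnePoint.infty <;> by_cases hw' : f w = OnePoint.infty
  · rw [hv', hw']
  · simp only [hv', coordAtInfty_infty, coordAtInfty_eq_inv hw'] at e
    exact absurd (inv_eq_zero.mp e.symm) (hwi hw')
  · simp only [hw', coordAtInfty_infty, coordAtInfty_eq_inv hv'] at e
    exact absurd (inv_eq_zero.mp e) (hvi hv')
  · simp only [coordAtInfty_eq_inv hv', coordAtInfty_eq_inv hw'] at e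
    rw [eq_coe_affineCoord hv', eq_coe_affineCoord hw', inv_injective e]

end IsConformalOnto

/-- The density at `ζ` of the pull-back by `f`, relative to `4 |dζ|²`, of the visual metric seen
from the point `x` of the half-space, raised to the power `1 / 2`. As a function of `x` its
superlevel sets are the horoballs centred at `f ζ`. -/
noncomputable def horoKernel (f : ℂ → Sphere) (x : ℂ × ℝ) (ζ : ℂ) : ℝ :=
  open Classical in
  if f ζ = OnePoint.infty then x.2 * ‖deriv (fun w => coordAtInfty (f w)) ζ‖
  else x.2 * ‖deriv (fun w => affineCoord (f w)) ζ‖ / (‖affineCoord (f ζ) - x.1‖ ^ 2 + x.2 ^ 2)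

theorem horoKernel_of_eq_infty (h : f ζ = OnePoint.infty) (x : ℂ × ℝ) :
    horoKernel f x ζ = x.2 * ‖deriv (fun w => coordAtInfty (f w)) ζ‖ := if_pos h

theorem horoKernel_of_ne_infty (h : f ζ ≠ OnePoint.infty) (x : ℂ × ℝ) :
    horoKernel f x ζ = x.2 * ‖deriv (fun w => affineCoord (f w)) ζ‖ /
      (‖affineCoord (f ζ) - x.1‖ ^ 2 + x.2 ^ 2) := if_neg h

/-- A local lift `(u₁, u₂)` of `f = [u₁ : u₂]` to `ℂ²`, with Wronskian of modulus `1`. It turns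
the kernel into the reciprocal of a Hermitian form in `(u₁, u₂)`, at poles of `f` as well. -/
theorem IsConformalOnto.exists_lift (hf : IsConformalOnto f Ω) (hζ : ζ ∈ disk) :
    ∃ u₁ u₂ : ℂ → ℂ, AnalyticAt ℂ u₁ ζ ∧ AnalyticAt ℂ u₂ ζ ∧
      ‖u₁ ζ * deriv u₂ ζ - deriv u₁ ζ * u₂ ζ‖ = 1 ∧
      (∀ᶠ w in 𝓝 ζ, ∀ x ∈ H3,
        horoKernel f x w = x.2 / (‖u₁ w - x.1 * u₂ w‖ ^ 2 + x.2 ^ 2 * ‖u₂ w‖ ^ 2)) ∧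
      ((f ζ = OnePoint.infty ∧ u₂ ζ = 0) ∨ ∃ z : ℂ, f ζ = (z : Sphere) ∧ u₁ ζ = z * u₂ ζ) := by
  by_cases h : f ζ = OnePoint.infty
  · have hg := hf.analyticAt_coordAtInfty hζ h
    obtain ⟨k, hk, hkn, hW⟩ := hg.exists_normalized_lift (hf.deriv_coordAtInfty_ne_zero hζ h)
    refine ⟨k, fun w => coordAtInfty (f w) * k w, hk, hg.mul hk, ?_, ?_, ?_⟩
    · rw [← hW, ← norm_neg]; congr 1; ring
    · have h1 := (eventually_nhdsWithin_iff.mp (hf.eventually_ne_infty hζ h))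
      filter_upwards [h1, hf.eventually_affineCoord_ne_zero hζ h, hkn] with w hw hw0 hkw x hx
      have hk0 : ‖k w‖ ^ 2 ≠ 0 := fun h0 => by simp [h0] at hkw
      rcases eq_or_ne w ζ with rfl | hne
      · rw [horoKernel_of_eq_infty h]
        simp only [h, coordAtInfty_infty, zero_mul, mul_zero, sub_zero, norm_zero]
        field_simp
        linear_combination x.2 * hkw
      · obtain ⟨hwd, hwi⟩ := hw hne
        have hF := hf.analyticAt_affineCoord hwd hwi
        set F := fun w => affineCoord (f w) with hFdef
        have e : (fun w => coordAtInfty (f w)) =ᶠ[𝓝 w] fun w => (F w)⁻¹ := by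
          filter_upwards [hf.eventually_ne hwd hwi] with v hv
          exact coordAtInfty_eq_inv hv
        have hF0 : F w ≠ 0 := hw0 hwi
        rw [e.deriv_eq, (hF.differentiableAt.hasDerivAt.fun_inv hF0).deriv] at hkw
        rw [horoKernel_of_ne_infty hwi, coordAtInfty_eq_inv hwi]
        change x.2 * ‖deriv F w‖ / (‖F w - x.1‖ ^ 2 + x.2 ^ 2) =
          x.2 / (‖k w - x.1 * ((F w)⁻¹ * k w)‖ ^ 2 + x.2 ^ 2 * ‖(F w)⁻¹ * k w‖ ^ 2)
        have hF0' : ‖F w‖ ≠ 0 := norm_ne_zero_iff.mpr hF0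
        have hx' : 0 < x.2 := hx
        have e2 : k w - x.1 * ((F w)⁻¹ * k w) = (F w - x.1) * ((F w)⁻¹ * k w) := by
          field_simp
        rw [e2, norm_mul, norm_mul, norm_inv]
        rw [norm_div, norm_neg, norm_pow] at hkw
        have hp : ‖F w - x.1‖ ^ 2 + x.2 ^ 2 ≠ 0 := by positivity
        have hk1 : ‖k w‖ ≠ 0 := fun h0 => hk0 (by rw [h0]; norm_num)
        have e3 : (‖F w - x.1‖ * (‖F w‖⁻¹ * ‖k w‖)) ^ 2 + x.2 ^ 2 * (‖F w‖⁻¹ * ‖k w‖) ^ 2 =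
          (‖F w - x.1‖ ^ 2 + x.2 ^ 2) * (‖k w‖ ^ 2 / ‖F w‖ ^ 2) := by field_simp
        rw [e3]
        have e4 : ‖deriv F w‖ = ‖F w‖ ^ 2 / ‖k w‖ ^ 2 := by
          field_simp at hkw ⊢
          linear_combination hkw
        rw [e4]; field_simp
    · exact Or.inl ⟨h, by simp [h, coordAtInfty_infty]⟩
  · have hg := hf.analyticAt_affineCoord hζ h
    obtain ⟨k, hk, hkn, hW⟩ := hg.exists_normalized_lift (hf.deriv_affineCoord_ne_zero hζ h)
    refine ⟨fun w => affineCoord (f w) * k w, k, hg.mul hk, hk, hW, ?_, ?_⟩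
    · filter_upwards [hf.eventually_ne hζ h, hkn] with w hwi hkw x hx
      rw [horoKernel_of_ne_infty hwi, ← sub_mul, norm_mul]
      have hx' : 0 < x.2 := hx
      have hp : ‖affineCoord (f w) - x.1‖ ^ 2 + x.2 ^ 2 ≠ 0 := by positivity
      have hk1 : ‖k w‖ ≠ 0 := fun h0 => by simp [h0] at hkw
      rw [mul_pow, ← add_mul]
      field_simp
      linear_combination hkw
    · exact Or.inr ⟨_, eq_coe_affineCoord h, rfl⟩

end

/-! ### Second order jets of curves -/

section Jets

variable {E : Type*} [NormedAddCommGroup E] [NormedSpace ℝ E]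

/-- The curve `c` is twice differentiable at `0`, with value `c₀`, velocity `c₁` and second
derivative `c₂`. -/
def HasJet (c : ℝ → E) (c₀ c₁ c₂ : E) : Prop :=
  ∃ c' : ℝ → E, c 0 = c₀ ∧ c' 0 = c₁ ∧ (∀ᶠ τ in 𝓝 0, HasDerivAt c (c' τ) τ) ∧ HasDerivAt c' c₂ 0

namespace HasJet

theorem congr {c d : ℝ → E} {c₀ c₁ c₂ d₀ d₁ d₂ : E} (hc : HasJet c c₀ c₁ c₂)
    (h : ∀ τ, c τ = d τ) (h₀ : c₀ = d₀) (h₁ : c₁ = d₁) (h₂ : c₂ = d₂) :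
    HasJet d d₀ d₁ d₂ := by
  rw [← funext h, ← h₀, ← h₁, ← h₂]; exact hc

theorem const (a : E) : HasJet (fun _ => a) a 0 0 :=
  ⟨fun _ => 0, rfl, rfl, Eventually.of_forall fun τ => hasDerivAt_const τ a, hasDerivAt_const _ _⟩

theorem line (a h : E) : HasJet (fun τ : ℝ => a + τ • h) a h 0 := by
  refine ⟨fun _ => h, by simp, rfl, Eventually.of_forall fun τ => ?_, hasDerivAt_const _ _⟩
  simpa using ((hasDerivAt_id τ).smul_const h).const_add a

theorem add {c d : ℝ → E} {c₀ c₁ c₂ d₀ d₁ d₂ : E} (hc : HasJet c c₀ c₁ c₂)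
    (hd : HasJet d d₀ d₁ d₂) : HasJet (fun τ => c τ + d τ) (c₀ + d₀) (c₁ + d₁) (c₂ + d₂) := by
  obtain ⟨c', rfl, rfl, h3, h4⟩ := hc
  obtain ⟨d', rfl, rfl, k3, k4⟩ := hd
  refine ⟨fun τ => c' τ + d' τ, rfl, rfl, ?_, h4.add k4⟩
  filter_upwards [h3, k3] with τ a b using a.add b

theorem sub {c d : ℝ → E} {c₀ c₁ c₂ d₀ d₁ d₂ : E} (hc : HasJet c c₀ c₁ c₂)
    (hd : HasJet d d₀ d₁ d₂) : HasJet (fun τ => c τ - d τ) (c₀ - d₀) (c₁ - d₁) (c₂ - d₂) := by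
  obtain ⟨c', rfl, rfl, h3, h4⟩ := hc
  obtain ⟨d', rfl, rfl, k3, k4⟩ := hd
  refine ⟨fun τ => c' τ - d' τ, rfl, rfl, ?_, h4.sub k4⟩
  filter_upwards [h3, k3] with τ a b using a.sub b

theorem mul {A : Type*} [NormedCommRing A] [NormedAlgebra ℝ A] {c d : ℝ → A}
    {c₀ c₁ c₂ d₀ d₁ d₂ : A} (hc : HasJet c c₀ c₁ c₂) (hd : HasJet d d₀ d₁ d₂) :
    HasJet (fun τ => c τ * d τ) (c₀ * d₀) (c₁ * d₀ + c₀ * d₁)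
      (c₂ * d₀ + 2 * (c₁ * d₁) + c₀ * d₂) := by
  obtain ⟨c', rfl, rfl, h3, h4⟩ := hc
  obtain ⟨d', rfl, rfl, k3, k4⟩ := hd
  refine ⟨fun τ => c' τ * d τ + c τ * d' τ, rfl, rfl, ?_, ?_⟩
  · filter_upwards [h3, k3] with τ a b using a.mul b
  · exact ((h4.mul k3.self_of_nhds).add (h3.self_of_nhds.mul k4)).congr_deriv (by ring)

theorem clm {F : Type*} [NormedAddCommGroup F] [NormedSpace ℝ F] (L : E →L[ℝ] F) {c : ℝ → E}
    {c₀ c₁ c₂ : E} (hc : HasJet c c₀ c₁ c₂) :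
    HasJet (fun τ => L (c τ)) (L c₀) (L c₁) (L c₂) := by
  obtain ⟨c', rfl, rfl, h3, h4⟩ := hc
  refine ⟨fun τ => L (c' τ), rfl, rfl, ?_, L.hasFDerivAt.comp_hasDerivAt _ h4⟩
  filter_upwards [h3] with τ a using L.hasFDerivAt.comp_hasDerivAt _ a

theorem sq_norm {c : ℝ → ℂ} {c₀ c₁ c₂ : ℂ} (hc : HasJet c c₀ c₁ c₂) :
    HasJet (fun τ => ‖c τ‖ ^ 2) (‖c₀‖ ^ 2) (2 * (starRingEnd ℂ c₀ * c₁).re)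
      (2 * ‖c₁‖ ^ 2 + 2 * (starRingEnd ℂ c₀ * c₂).re) := by
  have hr := hc.clm Complex.reCLM
  have hi := hc.clm Complex.imCLM
  refine ((hr.mul hr).add (hi.mul hi)).congr (fun τ => ?_) ?_ ?_ ?_
  · simp [← Complex.normSq_eq_norm_sq, Complex.normSq_apply]
  · simp [← Complex.normSq_eq_norm_sq, Complex.normSq_apply]
  · simp; ring
  · simp [← Complex.normSq_eq_norm_sq, Complex.normSq_apply]; ring

/-- The restriction of a holomorphic function to a line. -/
theorem of_analyticAt {u : ℂ → ℂ} {z : ℂ} (hu : AnalyticAt ℂ u z) (h : ℂ) :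
    HasJet (fun τ : ℝ => u (z + τ • h)) (u z) (deriv u z * h) (deriv (deriv u) z * h ^ 2) := by
  have hl : ∀ τ : ℝ, HasDerivAt (fun τ : ℝ => z + τ • h) h τ := fun τ => by
    simpa using ((hasDerivAt_id τ).smul_const h).const_add z
  have ht : Tendsto (fun τ : ℝ => z + τ • h) (𝓝 0) (𝓝 z) := by
    have := (hl 0).continuousAt.tendsto
    simpa using this
  refine ⟨fun τ => deriv u (z + τ • h) * h, by simp, by simp, ?_, ?_⟩
  · filter_upwards [ht.eventually hu.eventually_analyticAt] with τ hτ
    exact hτ.differentiableAt.hasDerivAt.comp τ (hl τ)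
  · have h1 : HasDerivAt (deriv u) (deriv (deriv u) z) (z + (0 : ℝ) • h) := by
      simpa using hu.deriv.differentiableAt.hasDerivAt
    have h2 := (h1.comp (0 : ℝ) (hl 0)).mul_const h
    exact h2.congr_deriv (by ring)

/-- The restriction of a smooth map to a line. -/
theorem of_contDiffAt {G : Type*} [NormedAddCommGroup G] [NormedSpace ℝ G] {u : G → E} {a : G}
    (hu : ContDiffAt ℝ 2 u a) (w : G) :
    HasJet (fun τ : ℝ => u (a + τ • w)) (u a) (fderiv ℝ u a w)
      (fderiv ℝ (fun b => fderiv ℝ u b w) a w) := by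
  have hl : ∀ τ : ℝ, HasDerivAt (fun τ : ℝ => a + τ • w) w τ := fun τ => by
    simpa using ((hasDerivAt_id τ).smul_const w).const_add a
  have ht : Tendsto (fun τ : ℝ => a + τ • w) (𝓝 0) (𝓝 a) := by
    have := (hl 0).continuousAt.tendsto
    simpa using this
  refine ⟨fun τ => fderiv ℝ u (a + τ • w) w, by simp, by simp, ?_, ?_⟩
  · have h1 : ∀ᶠ b in 𝓝 a, DifferentiableAt ℝ u b :=
      (hu.eventually (by simp)).mono fun b hb => hb.differentiableAt (by simp)
    filter_upwards [ht.eventually h1] with τ hτ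
    exact hτ.hasFDerivAt.comp_hasDerivAt τ (hl τ)
  · have h1 : DifferentiableAt ℝ (fun b => fderiv ℝ u b w) a :=
      ((hu.fderiv_right (m := 1) (by norm_num)).clm_apply contDiffAt_const).differentiableAt
        (by simp)
    have h2 : HasFDerivAt (fun b => fderiv ℝ u b w) (fderiv ℝ (fun b => fderiv ℝ u b w) a)
        (a + (0 : ℝ) • w) := by simpa using h1.hasFDerivAt
    exact h2.comp_hasDerivAt (0 : ℝ) (hl 0)

/-- First and second order conditions at a minimum. -/
theorem of_nonneg {c : ℝ → ℝ} {c₁ c₂ : ℝ} (hc : HasJet c 0 c₁ c₂)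
    (h : ∀ᶠ τ in 𝓝 0, 0 ≤ c τ) : c₁ = 0 ∧ 0 ≤ c₂ := by
  obtain ⟨c', h0, rfl, h3, h4⟩ := hc
  have hmin : IsLocalMin c 0 := by
    filter_upwards [h] with τ hτ
    rwa [h0]
  have h1 : c' 0 = 0 := hmin.hasDerivAt_eq_zero h3.self_of_nhds
  refine ⟨h1, ?_⟩
  by_contra! hneg
  have e : deriv c =ᶠ[𝓝 0] c' := h3.mono fun τ hτ => hτ.deriv
  -- A negative second derivative would make `0` a local maximum as well.
  have hmax : IsLocalMax c 0 := isLocalMax_of_deriv_deriv_neg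
    (by rw [e.deriv_eq, h4.deriv]; exact hneg) (by rw [e.self_of_nhds, h1])
    h3.self_of_nhds.continuousAt
  have hconst : c =ᶠ[𝓝 0] fun _ => c 0 := by
    filter_upwards [hmin, hmax] with τ h1 h2 using le_antisymm h2 h1
  have e2 : c' =ᶠ[𝓝 0] fun _ => 0 := by
    filter_upwards [e, hconst.deriv] with τ h1 h2
    rw [← h1, h2]; simp
  have := e2.deriv_eq
  rw [h4.deriv, deriv_const] at this
  exact hneg.ne this

end HasJet

end Jets

/-! ### The second variation at a point of tangency -/

theorem sq_add_sq_eq_zero_of_norm_eq_of_orthogonal {a b : ℂ} (h : ‖a‖ ^ 2 = ‖b‖ ^ 2)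
    (h' : (a * conj b).re = 0) : a ^ 2 + b ^ 2 = 0 := by
  simp only [← Complex.normSq_eq_norm_sq, Complex.normSq_apply] at h
  simp only [Complex.mul_re, Complex.conj_re, Complex.conj_im] at h'
  by_cases hb : b = 0
  · subst hb
    simp at h
    have : a = 0 := by
      apply Complex.ext
      · simp; nlinarith [mul_self_nonneg a.re, mul_self_nonneg a.im]
      · simp; nlinarith [mul_self_nonneg a.re, mul_self_nonneg a.im]
    simp [this]
  · have hb' : 0 < b.re ^ 2 + b.im ^ 2 := by
      have := Complex.normSq_pos.mpr hb
      rw [Complex.normSq_apply] at this; nlinarith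
    apply Complex.ext
    · simp [pow_two]
      have : (b.re ^ 2 + b.im ^ 2) *
          (a.re * a.re - a.im * a.im + (b.re * b.re - b.im * b.im)) = 0 := by
        linear_combination -(b.re ^ 2 - b.im ^ 2) * h + 2 * (a.re * b.re - a.im * b.im) * h'
      exact (mul_eq_zero.mp this).resolve_left hb'.ne'
    · simp [pow_two]
      have : (b.re ^ 2 + b.im ^ 2) *
          (a.re * a.im + a.im * a.re + (b.re * b.im + b.im * b.re)) = 0 := by
        linear_combination -2 * b.re * b.im * h + 2 * (a.re * b.im + a.im * b.re) * h'
      exact (mul_eq_zero.mp this).resolve_left hb'.ne'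

/-- The first variation of `|u₁ - Z u₂|² + ξ² |u₂|² - κ (r² - |ζ|²) ξ` under variations `(V, ν)` of
the point `(Z, ξ)` of the half-space; here `y = u₁ - Z u₂`, `b = u₂` and `ρ = κ (r² - |ζ|²)`. -/
noncomputable def spaceVariation (y b : ℂ) (ξ ρ : ℝ) (V : ℂ) (ν : ℝ) : ℝ :=
  -2 * (conj y * b * V).re + 2 * ξ * ‖b‖ ^ 2 * ν - ρ * ν

/-- The second variation of `|u₁ - Z u₂|² + ξ² |u₂|² - κ (r² - |ζ|²) ξ` along a curve with
velocity `(V, ν)` and acceleration `(W, σ)` of the point `(Z, ξ)` and constant velocity `h`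
of `ζ`; here `y = u₁ - Z u₂`, `y'` and `y''` are the `ζ`-derivatives of `y` with `Z` fixed,
`b`, `b'` and `b''` those of `u₂`, and `ρ = κ (r² - |ζ|²)`. -/
noncomputable def secondVariation (y y' y'' b b' b'' ζ : ℂ) (ξ κ ρ : ℝ) (V : ℂ) (ν : ℝ) (W : ℂ)
    (σ : ℝ) (h : ℂ) : ℝ :=
  2 * ‖y' * h - V * b‖ ^ 2 + 2 * (conj y * (y'' * h ^ 2 - W * b - 2 * (V * (b' * h)))).re +
    (2 * ‖ν * b + ξ * (b' * h)‖ ^ 2 +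
      2 * (conj (ξ * b) * (σ * b + 2 * (ν * (b' * h)) + ξ * (b'' * h ^ 2))).re) +
    (2 * κ * ‖h‖ ^ 2 * ξ + 4 * κ * (conj ζ * h).re * ν - ρ * σ)

/-- The decomposition of the second variation into the part linear in the acceleration, the
Hermitian and the complex quadratic parts in `h`, and the mixed part. -/
theorem secondVariation_eq (y y' y'' b b' b'' ζ : ℂ) (ξ κ ρ : ℝ) (V : ℂ) (ν : ℝ) (W : ℂ)
    (σ : ℝ) (h : ℂ) : secondVariation y y' y'' b b' b'' ζ ξ κ ρ V ν W σ h =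
      spaceVariation y b ξ ρ W σ + 2 * (‖V‖ ^ 2 + ν ^ 2) * ‖b‖ ^ 2 +
      2 * (‖y'‖ ^ 2 + ‖ξ * b'‖ ^ 2 + κ * ξ) * ‖h‖ ^ 2 +
      2 * ((conj y * y'' + ξ ^ 2 * conj b * b'') * h ^ 2).re +
      4 * (h * (-(conj V * conj b * y') - conj y * V * b' + ν * conj b * (ξ * b') +
        ξ * conj b * ν * b' + κ * ν * conj ζ)).re := by
  simp only [secondVariation, spaceVariation, ← Complex.normSq_eq_norm_sq, Complex.normSq_apply]
  simp only [Complex.mul_re, Complex.mul_im, Complex.add_re, Complex.add_im, Complex.sub_re,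
    Complex.sub_im, Complex.conj_re, Complex.conj_im, Complex.ofReal_re, Complex.ofReal_im, pow_two,
    Complex.neg_re, Complex.neg_im, Complex.re_ofNat, Complex.im_ofNat, mul_zero]
  ring

/-- Polarization identity: up to scale, the normal component `N` and the complex tangential
component `D` of a vector are the coordinates of an isometry `ℂ × ℝ → ℂ × ℝ`. -/
theorem re_mul_conj_add_mul_eq (y e V₁ V₂ : ℂ) (ν₁ ν₂ : ℝ) :
    ((-conj V₁ * y ^ 2 + 2 * ν₁ * (y * e) + V₁ * e ^ 2) *
      conj (-conj V₂ * y ^ 2 + 2 * ν₂ * (y * e) + V₂ * e ^ 2)).re +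
      (ν₁ * (‖e‖ ^ 2 - ‖y‖ ^ 2) - 2 * (conj y * e * V₁).re) *
      (ν₂ * (‖e‖ ^ 2 - ‖y‖ ^ 2) - 2 * (conj y * e * V₂).re) =
    (‖y‖ ^ 2 + ‖e‖ ^ 2) ^ 2 * ((V₁ * conj V₂).re + ν₁ * ν₂) := by
  simp only [← Complex.normSq_eq_norm_sq, Complex.normSq_apply]
  simp only [Complex.mul_re, Complex.mul_im, Complex.add_re, Complex.add_im,
    Complex.conj_re, Complex.conj_im, Complex.ofReal_re, Complex.ofReal_im, pow_two, Complex.neg_re,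
    Complex.neg_im, Complex.re_ofNat, Complex.im_ofNat]
  ring

/-- The mixed part of the second variation, in terms of the complex tangential component of
`(V, ν)` and the Wronskian of the lift. The last summand vanishes for tangent vectors. -/
theorem mixed_part_eq (y y' e e' V : ℂ) (ν : ℝ) :
    (y * conj y + e * conj e) *
        (-(conj V * conj e * y') - conj y * V * e' + ν * (conj e * e' - conj y * y')) =
      conj (-conj V * y ^ 2 + 2 * ν * (y * e) + V * e ^ 2) * (y * e' - e * y') +
      (ν * (e * conj e - y * conj y) - (conj y * e * V + y * conj e * conj V)) *
        (conj y * y' + conj e * e') := by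
  simp only [map_add, map_mul, map_neg, map_pow, Complex.conj_conj, Complex.conj_ofReal,
    map_ofNat]
  ring

theorem lagrange_identity (y y' e e' : ℂ) :
    (‖y‖ ^ 2 + ‖e‖ ^ 2) * (‖y'‖ ^ 2 + ‖e'‖ ^ 2) =
      ‖conj y * y' + conj e * e'‖ ^ 2 + ‖y * e' - e * y'‖ ^ 2 := by
  simp only [← Complex.normSq_eq_norm_sq, Complex.normSq_apply]
  simp only [Complex.mul_re, Complex.mul_im, Complex.add_re, Complex.add_im, Complex.sub_re,
    Complex.sub_im, Complex.conj_re, Complex.conj_im]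
  ring

/-- The heart of the maximum principle. At a minimum of the comparison function over the product
of a minimal surface (with orthonormal tangent frame `(V₁, ν₁)`, `(V₂, ν₂)` and total acceleration
prescribed by minimality) and the disk of radius `r`, the constant `κ r` is at least `1`. The
second variations along the two frame vectors are added up, each coupled with a displacement
`hᵢ` of `ζ` such that `h₁² + h₂² = 0`, which removes the second derivatives of the lift. -/
theorem one_le_sq_of_secondVariation_nonneg {y y' y'' b b' b'' ζ : ℂ} {ξ κ r : ℝ} (hξ : 0 < ξ)
    (h0 : ‖y‖ ^ 2 + ξ ^ 2 * ‖b‖ ^ 2 = κ * (r ^ 2 - ‖ζ‖ ^ 2) * ξ)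
    (hW : ‖y * b' - y' * b‖ = 1)
    (hcrit : conj y * y' + ξ ^ 2 * conj b * b' = -(κ * ξ * conj ζ))
    {V₁ V₂ W₁ W₂ : ℂ} {ν₁ ν₂ σ₁ σ₂ α β : ℝ}
    (hN₁ : spaceVariation y b ξ (κ * (r ^ 2 - ‖ζ‖ ^ 2)) V₁ ν₁ = 0)
    (hN₂ : spaceVariation y b ξ (κ * (r ^ 2 - ‖ζ‖ ^ 2)) V₂ ν₂ = 0)
    (h₁ : ‖V₁‖ ^ 2 + ν₁ ^ 2 = ξ ^ 2) (h₂ : ‖V₂‖ ^ 2 + ν₂ ^ 2 = ξ ^ 2)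
    (h₁₂ : (V₁ * conj V₂).re + ν₁ * ν₂ = 0)
    (hmW : W₁ + W₂ = α * V₁ + β * V₂ + 2 / ξ * (ν₁ * V₁ + ν₂ * V₂))
    (hmσ : σ₁ + σ₂ = α * ν₁ + β * ν₂ + 2 / ξ * (ν₁ * ν₁ + ν₂ * ν₂) - 2 * ξ)
    (hsec : ∀ k₁ k₂ : ℂ,
      0 ≤ secondVariation y y' y'' b b' b'' ζ ξ κ (κ * (r ^ 2 - ‖ζ‖ ^ 2)) V₁ ν₁ W₁ σ₁ k₁ +
        secondVariation y y' y'' b b' b'' ζ ξ κ (κ * (r ^ 2 - ‖ζ‖ ^ 2)) V₂ ν₂ W₂ σ₂ k₂) :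
    1 ≤ (κ * r) ^ 2 := by
  set ρ := κ * (r ^ 2 - ‖ζ‖ ^ 2) with hρ
  set e : ℂ := ξ * b with he
  set e' : ℂ := ξ * b' with he'
  set w : ℂ := y * b' - y' * b with hw
  have hne : ‖e‖ ^ 2 = ξ ^ 2 * ‖b‖ ^ 2 := by
    rw [he, norm_mul, Complex.norm_real, mul_pow, Real.norm_eq_abs, sq_abs]
  set R := ‖y‖ ^ 2 + ‖e‖ ^ 2 with hR
  have hRρ : R = ρ * ξ := by rw [hR, hne, h0]
  have hRpos : 0 < R := by
    by_contra hcon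
    have hz : R = 0 := le_antisymm (not_lt.mp hcon) (by positivity)
    have hy : y = 0 := by
      have : ‖y‖ ^ 2 = 0 := by nlinarith [sq_nonneg ‖y‖, sq_nonneg ‖e‖]
      simpa using this
    have hb : b = 0 := by
      have : ‖e‖ ^ 2 = 0 := by nlinarith [sq_nonneg ‖y‖, sq_nonneg ‖e‖]
      have : e = 0 := by simpa using this
      simpa [he, hξ.ne'] using this
    rw [hw, hy, hb] at hW
    simp at hW
  have hnormal : ∀ (V : ℂ) (ν : ℝ), ν * (‖e‖ ^ 2 - ‖y‖ ^ 2) - 2 * (conj y * e * V).re =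
      ξ * spaceVariation y b ξ ρ V ν := by
    intro V ν
    have e1 : (conj y * e * V).re = ξ * (conj y * b * V).re := by
      rw [← Complex.re_ofReal_mul, he]; congr 1; ring
    rw [e1, spaceVariation]
    have e2 : ‖y‖ ^ 2 = ρ * ξ - ‖e‖ ^ 2 := by rw [← hRρ, hR]; ring
    rw [e2, hne]; ring
  set D : ℂ → ℝ → ℂ := fun V ν => -conj V * y ^ 2 + 2 * ν * (y * e) + V * e ^ 2 with hD
  have hDn : ∀ (V : ℂ) (ν : ℝ), spaceVariation y b ξ ρ V ν = 0 → ‖V‖ ^ 2 + ν ^ 2 = ξ ^ 2 →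
      ‖D V ν‖ ^ 2 = R ^ 2 * ξ ^ 2 := by
    intro V ν hN hV
    have := re_mul_conj_add_mul_eq y e V V ν ν
    rw [hnormal, hN, Complex.mul_conj, Complex.mul_conj, Complex.ofReal_re, Complex.ofReal_re,
      Complex.normSq_eq_norm_sq, Complex.normSq_eq_norm_sq] at this
    rw [hR, ← hV]
    linear_combination this
  have hD12 : (D V₁ ν₁ * conj (D V₂ ν₂)).re = 0 := by
    have := re_mul_conj_add_mul_eq y e V₁ V₂ ν₁ ν₂
    rw [hnormal, hN₁, h₁₂] at this
    linear_combination this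
  have hsq : D V₁ ν₁ ^ 2 + D V₂ ν₂ ^ 2 = 0 :=
    sq_add_sq_eq_zero_of_norm_eq_of_orthogonal ((hDn _ _ hN₁ h₁).trans (hDn _ _ hN₂ h₂).symm) hD12
  -- The choice of the displacement of `ζ` that makes the mixed term as negative as possible.
  set l : ℝ := 1 / (2 * ξ ^ 2) with hl
  set k : ℂ → ℝ → ℂ := fun V ν => -(l * (D V ν * conj w)) with hk
  have hkn : ∀ (V : ℂ) (ν : ℝ), spaceVariation y b ξ ρ V ν = 0 → ‖V‖ ^ 2 + ν ^ 2 = ξ ^ 2 →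
      ‖k V ν‖ ^ 2 = l ^ 2 * (R ^ 2 * ξ ^ 2) := by
    intro V ν hN hV
    rw [hk, ← hDn V ν hN hV]
    simp only [norm_neg, norm_mul, Complex.norm_real, RCLike.norm_conj, hW, mul_one, mul_pow,
      Real.norm_eq_abs, sq_abs]
  have hmix : ∀ (V : ℂ) (ν : ℝ), spaceVariation y b ξ ρ V ν = 0 → ‖V‖ ^ 2 + ν ^ 2 = ξ ^ 2 →
      (k V ν * (-(conj V * conj b * y') - conj y * V * b' + ν * conj b * (ξ * b') +
        ξ * conj b * ν * b' + κ * ν * conj ζ)).re = -(l * (R * ξ ^ 2)) := by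
    intro V ν hN hV
    set c := -(conj V * conj b * y') - conj y * V * b' + ν * conj b * (ξ * b') +
        ξ * conj b * ν * b' + κ * ν * conj ζ with hc
    have hξ' : (ξ : ℂ) ≠ 0 := by exact_mod_cast hξ.ne'
    have hce : conj e = ξ * conj b := by rw [he, map_mul, Complex.conj_ofReal]
    have h1 : ξ * c = -(conj V * conj e * y') - conj y * V * e' +
        ν * (conj e * e' - conj y * y') := by
      rw [hc, hce, he']
      linear_combination (ν : ℂ) * hcrit
    have hRc : (R : ℂ) = y * conj y + e * conj e := by
      rw [Complex.mul_conj, Complex.mul_conj, Complex.normSq_eq_norm_sq,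
        Complex.normSq_eq_norm_sq, hR]
      push_cast; rfl
    have hNc : (ν * (e * conj e - y * conj y) -
        (conj y * e * V + y * conj e * conj V) : ℂ) = 0 := by
      have e3 : (conj y * e * V + y * conj e * conj V : ℂ) =
          ((2 * (conj y * e * V).re : ℝ) : ℂ) := by
        have := Complex.add_conj (conj y * e * V)
        rw [map_mul, map_mul, Complex.conj_conj] at this
        rw [this]
      have := hnormal V ν
      rw [hN, mul_zero] at this
      rw [e3, Complex.mul_conj, Complex.mul_conj, Complex.normSq_eq_norm_sq,
        Complex.normSq_eq_norm_sq]
      exact_mod_cast this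
    have h2 : (R : ℂ) * c = conj (D V ν) * w := by
      have := mixed_part_eq y y' e e' V ν
      rw [← hRc, ← h1, hNc, zero_mul, add_zero] at this
      have h3 : y * e' - e * y' = ξ * w := by rw [he, he', hw]; ring
      rw [h3] at this
      apply mul_left_cancel₀ hξ'
      linear_combination this
    have h4 : (R : ℂ) * (k V ν * c) = ((-(l * (R ^ 2 * ξ ^ 2)) : ℝ) : ℂ) := by
      have h5 : D V ν * conj (D V ν) = ((R ^ 2 * ξ ^ 2 : ℝ) : ℂ) := by
        rw [Complex.mul_conj, Complex.normSq_eq_norm_sq, hDn V ν hN hV]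
      have h6 : w * conj w = 1 := by
        rw [Complex.mul_conj, Complex.normSq_eq_norm_sq, hW]; norm_num
      calc (R : ℂ) * (k V ν * c) = k V ν * (R * c) := by ring
        _ = -(l * ((D V ν * conj (D V ν)) * (w * conj w))) := by rw [h2, hk]; ring
        _ = _ := by rw [h5, h6]; push_cast; ring
    have h7 := congrArg Complex.re h4
    rw [Complex.re_ofReal_mul, Complex.ofReal_re] at h7
    apply mul_left_cancel₀ hRpos.ne'
    rw [h7]; ring
  have key := hsec (k V₁ ν₁) (k V₂ ν₂)
  rw [secondVariation_eq, secondVariation_eq, hkn _ _ hN₁ h₁, hkn _ _ hN₂ h₂, hmix _ _ hN₁ h₁,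
    hmix _ _ hN₂ h₂, h₁, h₂] at key
  have hq : ((conj y * y'' + ξ ^ 2 * conj b * b'') * k V₁ ν₁ ^ 2).re +
      ((conj y * y'' + ξ ^ 2 * conj b * b'') * k V₂ ν₂ ^ 2).re = 0 := by
    rw [← Complex.add_re, ← mul_add]
    have : k V₁ ν₁ ^ 2 + k V₂ ν₂ ^ 2 = (l * conj w) ^ 2 * (D V₁ ν₁ ^ 2 + D V₂ ν₂ ^ 2) := by
      rw [hk]; ring
    rw [this, hsq]; simp
  have hlin : spaceVariation y b ξ ρ W₁ σ₁ + spaceVariation y b ξ ρ W₂ σ₂ =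
      2 * R - 4 * ξ ^ 2 * ‖b‖ ^ 2 := by
    have hadd : spaceVariation y b ξ ρ W₁ σ₁ + spaceVariation y b ξ ρ W₂ σ₂ =
        spaceVariation y b ξ ρ (W₁ + W₂) (σ₁ + σ₂) := by
      simp only [spaceVariation, mul_add, Complex.add_re]; ring
    have hcomb : spaceVariation y b ξ ρ (W₁ + W₂) (σ₁ + σ₂) =
        (α + 2 / ξ * ν₁) * spaceVariation y b ξ ρ V₁ ν₁ +
        (β + 2 / ξ * ν₂) * spaceVariation y b ξ ρ V₂ ν₂ +
        spaceVariation y b ξ ρ 0 (-2 * ξ) := by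
      have e4 : conj y * b * (W₁ + W₂) = ((α + 2 / ξ * ν₁ : ℝ) : ℂ) * (conj y * b * V₁) +
          ((β + 2 / ξ * ν₂ : ℝ) : ℂ) * (conj y * b * V₂) := by
        rw [hmW]; push_cast; ring
      simp only [spaceVariation, e4, hmσ, Complex.add_re, Complex.re_ofReal_mul, mul_zero,
        Complex.zero_re]
      ring
    rw [hadd, hcomb, hN₁, hN₂, spaceVariation, hRρ]
    simp only [mul_zero, Complex.zero_re]
    ring
  have hK : R * (‖y'‖ ^ 2 + ‖e'‖ ^ 2 + κ * ξ) = ξ ^ 2 * (1 + (κ * r) ^ 2) := by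
    have hL := lagrange_identity y y' e e'
    have e5 : conj y * y' + conj e * e' = -(((κ * ξ : ℝ) : ℂ) * conj ζ) := by
      have hce : conj e = ξ * conj b := by rw [he, map_mul, Complex.conj_ofReal]
      rw [hce, he']; push_cast; linear_combination hcrit
    have e6 : ‖conj y * y' + conj e * e'‖ ^ 2 = (κ * ξ) ^ 2 * ‖ζ‖ ^ 2 := by
      rw [e5, norm_neg, norm_mul, RCLike.norm_conj, Complex.norm_real, mul_pow, Real.norm_eq_abs,
        sq_abs]
    have e7 : ‖y * e' - e * y'‖ ^ 2 = ξ ^ 2 := by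
      have : y * e' - e * y' = ξ * w := by rw [he, he', hw]; ring
      rw [this, norm_mul, hW, Complex.norm_real, mul_one, Real.norm_eq_abs, sq_abs]
    rw [e6, e7, ← hR] at hL
    rw [mul_add, hL, hRρ, hρ]
    ring
  have hlξ : l * ξ ^ 2 = 1 / 2 := by rw [hl]; field_simp
  set K := ‖y'‖ ^ 2 + ‖e'‖ ^ 2 + κ * ξ with hKdef
  have e8 : 2 * R - 8 * (l * ξ ^ 2) * R + 4 * (R * K) * R * (l ^ 2 * ξ ^ 2) ≥ 0 := by
    linear_combination key + 2 * hq + hlin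
  rw [hlξ, hK] at e8
  have e9 : R * ((κ * r) ^ 2 - 1) ≥ 0 := by
    have e10 : ξ ^ 2 * (1 + (κ * r) ^ 2) * R * (l ^ 2 * ξ ^ 2) =
      (l * ξ ^ 2) ^ 2 * (1 + (κ * r) ^ 2) * R := by ring
    rw [hlξ] at e10
    linear_combination e8 + 4 * e10
  have := nonneg_of_mul_nonneg_right e9 hRpos
  linarith

/-! ### Frames of minimal surfaces -/

section Frames

theorem euclInner_comm (v w : ℂ × ℝ) : euclInner v w = euclInner w v := by
  simp only [euclInner]; ring

theorem euclInner_add_left (v v' w : ℂ × ℝ) :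
    euclInner (v + v') w = euclInner v w + euclInner v' w := by
  simp only [euclInner, Prod.fst_add, Prod.snd_add, Complex.add_re, Complex.add_im]; ring

theorem euclInner_smul_left (c : ℝ) (v w : ℂ × ℝ) : euclInner (c • v) w = c * euclInner v w := by
  simp only [euclInner, Prod.smul_fst, Prod.smul_snd, Complex.real_smul, Complex.re_ofReal_mul,
    Complex.im_ofReal_mul, smul_eq_mul]
  ring

theorem euclInner_add_right (v w w' : ℂ × ℝ) :
    euclInner v (w + w') = euclInner v w + euclInner v w' := by
  rw [euclInner_comm, euclInner_add_left, euclInner_comm w, euclInner_comm w']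

theorem euclInner_smul_right (c : ℝ) (v w : ℂ × ℝ) : euclInner v (c • w) = c * euclInner v w := by
  rw [euclInner_comm, euclInner_smul_left, euclInner_comm w]

theorem euclInner_self (v : ℂ × ℝ) : euclInner v v = ‖v.1‖ ^ 2 + v.2 ^ 2 := by
  rw [← Complex.normSq_eq_norm_sq, Complex.normSq_apply]; simp only [euclInner]; ring

theorem euclInner_self_pos {v : ℂ × ℝ} (hv : v ≠ 0) : 0 < euclInner v v := by
  rw [euclInner_self]
  by_cases h : v.1 = 0
  · have : v.2 ≠ 0 := fun h2 => hv (Prod.ext h h2)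
    positivity
  · positivity

theorem christoffel_comm (x v w : ℂ × ℝ) : christoffel x v w = christoffel x w v := by
  simp only [christoffel, euclInner_comm v w]
  congr 2
  abel

theorem christoffel_add_left (x v v' w : ℂ × ℝ) :
    christoffel x (v + v') w = christoffel x v w + christoffel x v' w := by
  simp only [christoffel, euclInner_add_left]
  rw [show ((0 : ℂ), euclInner v w + euclInner v' w) =
    ((0 : ℂ), euclInner v w) + ((0 : ℂ), euclInner v' w) by simp]
  simp only [Prod.snd_add]
  module

theorem christoffel_smul_left (x : ℂ × ℝ) (c : ℝ) (v w : ℂ × ℝ) :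
    christoffel x (c • v) w = c • christoffel x v w := by
  simp only [christoffel, euclInner_smul_left]
  rw [show ((0 : ℂ), c * euclInner v w) = c • ((0 : ℂ), euclInner v w) by simp]
  simp only [Prod.smul_snd, smul_eq_mul]
  module

/-- A proper minimal immersion in a chart, at a point `x = u a`: there are tangent vectors `w₁`,
`w₂` of the parameter plane whose images are orthonormal for the hyperbolic metric, and the sum of
the covariant accelerations in these directions is tangent to the surface. -/
theorem exists_frame_of_meanCurvature_eq_zero {u : Plane → ℂ × ℝ} {a : Plane}
    (hu : ContDiffAt ℝ 2 u a) (hinj : Function.Injective (fderiv ℝ u a)) (hpos : 0 < (u a).2)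
    (hmin : ∀ n : ℂ × ℝ, (∀ i, hypInner (u a) (partialD u i a) n = 0) →
      meanCurvature u n a = 0) :
    ∃ w₁ w₂ : Plane, ∃ α β : ℝ,
      euclInner (fderiv ℝ u a w₁) (fderiv ℝ u a w₁) = (u a).2 ^ 2 ∧
      euclInner (fderiv ℝ u a w₂) (fderiv ℝ u a w₂) = (u a).2 ^ 2 ∧
      euclInner (fderiv ℝ u a w₁) (fderiv ℝ u a w₂) = 0 ∧
      fderiv ℝ (fun b => fderiv ℝ u b w₁) a w₁ + fderiv ℝ (fun b => fderiv ℝ u b w₂) a w₂ +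
        christoffel (u a) (fderiv ℝ u a w₁) (fderiv ℝ u a w₁) +
        christoffel (u a) (fderiv ℝ u a w₂) (fderiv ℝ u a w₂) =
      α • fderiv ℝ u a w₁ + β • fderiv ℝ u a w₂ := by
  set ξ := (u a).2 with hξ
  have hξ2 : 0 < ξ ^ 2 := by positivity
  set L := fderiv ℝ u a with hL
  set Q := fderiv ℝ (fderiv ℝ u) a with hQ
  have hdd : DifferentiableAt ℝ (fderiv ℝ u) a :=
    (hu.fderiv_right (m := 1) (by norm_num)).differentiableAt (by simp)
  have hQw : ∀ w w' : Plane, fderiv ℝ (fun b => fderiv ℝ u b w) a w' = Q w' w := by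
    intro w w'
    rw [fderiv_clm_apply hdd (differentiableAt_const w)]
    simp [hQ]
  have hsymm : ∀ w w' : Plane, Q w w' = Q w' w := fun w w' =>
    (hu.isSymmSndFDerivAt (by simp)) w w'
  set e₀ : Plane := EuclideanSpace.single 0 1 with he₀
  set e₁ : Plane := EuclideanSpace.single 1 1 with he₁
  have hne : ∀ s : ℝ, e₁ + s • e₀ ≠ 0 := by
    intro s h
    have := congrArg (fun v : Plane => v 1) h
    simp [he₀, he₁] at this
  have hne0 : e₀ ≠ 0 := by
    intro h
    have := congrArg (fun v : Plane => v 0) h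
    simp [he₀] at this
  have hL0 : ∀ w, w ≠ 0 → L w ≠ 0 := fun w hw h => hw (hinj (by rw [h, map_zero]))
  set E := firstForm u 0 0 a with hE
  set F := firstForm u 0 1 a with hF
  set G := firstForm u 1 1 a with hG
  have hE' : euclInner (L e₀) (L e₀) = E * ξ ^ 2 := by
    rw [hE, firstForm, hypInner, div_mul_cancel₀ _ hξ2.ne']; rfl
  have hF' : euclInner (L e₀) (L e₁) = F * ξ ^ 2 := by
    rw [hF, firstForm, hypInner, div_mul_cancel₀ _ hξ2.ne']; rfl
  have hG' : euclInner (L e₁) (L e₁) = G * ξ ^ 2 := by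
    rw [hG, firstForm, hypInner, div_mul_cancel₀ _ hξ2.ne']; rfl
  have hEpos : 0 < E := by
    have := euclInner_self_pos (hL0 _ hne0)
    rw [hE'] at this
    exact pos_of_mul_pos_left this hξ2.le
  have hDpos : 0 < E * G - F ^ 2 := by
    have := euclInner_self_pos (hL0 _ (hne (-(F / E))))
    rw [map_add, map_smul] at this
    simp only [euclInner_add_left, euclInner_add_right, euclInner_smul_left, euclInner_smul_right,
      euclInner_comm (L e₁) (L e₀), hE', hF', hG'] at this
    have e : G * ξ ^ 2 + -(F / E) * (F * ξ ^ 2) +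
        (-(F / E) * (F * ξ ^ 2 + -(F / E) * (E * ξ ^ 2))) =
      (E * G - F ^ 2) * (ξ ^ 2 / E) := by field_simp; ring
    have h2 : 0 < (E * G - F ^ 2) * (ξ ^ 2 / E) := by
      rw [← e]; linarith
    exact pos_of_mul_pos_left h2 (by positivity)
  set Δ := E * G - F ^ 2 with hΔ
  set p := (Real.sqrt E)⁻¹ with hp
  set q := (Real.sqrt (E * Δ))⁻¹ with hq
  have hp2 : p ^ 2 = 1 / E := by rw [hp, inv_pow, Real.sq_sqrt hEpos.le, one_div]
  have hq2 : q ^ 2 = 1 / (E * Δ) := by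
    rw [hq, inv_pow, Real.sq_sqrt (by positivity), one_div]
  set w₁ : Plane := p • e₀ with hw₁
  set w₂ : Plane := (-(F * q)) • e₀ + (E * q) • e₁ with hw₂
  have hLw₁ : L w₁ = p • L e₀ := by rw [hw₁, map_smul]
  have hLw₂ : L w₂ = (-(F * q)) • L e₀ + (E * q) • L e₁ := by rw [hw₂, map_add, map_smul, map_smul]
  have h11 : euclInner (L w₁) (L w₁) = ξ ^ 2 := by
    rw [hLw₁, euclInner_smul_left, euclInner_smul_right, hE']
    have : p * (p * (E * ξ ^ 2)) = p ^ 2 * (E * ξ ^ 2) := by ring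
    rw [this, hp2]; field_simp
  have h12 : euclInner (L w₁) (L w₂) = 0 := by
    rw [hLw₁, hLw₂, euclInner_smul_left, euclInner_add_right, euclInner_smul_right,
      euclInner_smul_right, hE', hF']
    ring
  have h22 : euclInner (L w₂) (L w₂) = ξ ^ 2 := by
    rw [hLw₂]
    simp only [euclInner_add_left, euclInner_add_right, euclInner_smul_left, euclInner_smul_right,
      euclInner_comm (L e₁) (L e₀), hE', hF', hG']
    have : -(F * q) * (-(F * q) * (E * ξ ^ 2)) + E * q * (-(F * q) * (F * ξ ^ 2)) +
        (-(F * q) * (E * q * (F * ξ ^ 2)) + E * q * (E * q * (G * ξ ^ 2))) =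
        q ^ 2 * (E * Δ) * ξ ^ 2 := by rw [hΔ]; ring
    have h3 : q ^ 2 * (E * Δ) = 1 := by rw [hq2]; field_simp
    rw [h3] at this
    linarith
  set C : Plane → Plane → ℂ × ℝ := fun w w' => Q w w' + christoffel (u a) (L w) (L w') with hC
  have hCs : ∀ w w', C w w' = C w' w := fun w w' => by
    simp only [hC, hsymm w w', christoffel_comm _ (L w)]
  have hCadd : ∀ w w' v, C (w + w') v = C w v + C w' v := fun w w' v => by
    simp only [hC, map_add, christoffel_add_left, add_apply]; abel
  have hCsmul : ∀ (c : ℝ) w v, C (c • w) v = c • C w v := fun c w v => by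
    simp only [hC, map_smul, christoffel_smul_left, smul_apply, smul_add]
  have hcov : ∀ i j, covD u i j a = C (EuclideanSpace.single i 1) (EuclideanSpace.single j 1) := by
    intro i j
    simp only [covD, hC]
    rw [← hQw]; rfl
  set H := C w₁ w₁ + C w₂ w₂ with hH
  have hHe : H = (G / Δ) • C e₀ e₀ + (-2 * F / Δ) • C e₀ e₁ + (E / Δ) • C e₁ e₁ := by
    have x1 : C w₁ w₁ = p ^ 2 • C e₀ e₀ := by
      rw [hw₁, hCsmul, hCs, hCsmul, smul_smul, pow_two]
    have x2 : C w₂ w₂ = (F ^ 2 * q ^ 2) • C e₀ e₀ + (-2 * (E * F * q ^ 2)) • C e₀ e₁ +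
        (E ^ 2 * q ^ 2) • C e₁ e₁ := by
      rw [hw₂, hCadd, hCsmul, hCsmul, hCs e₀, hCs e₁, hCadd, hCadd, hCsmul, hCsmul, hCsmul, hCsmul,
        hCs e₁ e₀]
      module
    rw [hH, x1, x2, hp2, hq2]
    have y1 : 1 / E + F ^ 2 * (1 / (E * Δ)) = G / Δ := by
      rw [hΔ] at hDpos ⊢; field_simp; ring
    have y2 : -2 * (E * F * (1 / (E * Δ))) = -2 * F / Δ := by field_simp
    have y3 : E ^ 2 * (1 / (E * Δ)) = E / Δ := by field_simp
    rw [y2, y3, ← y1]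
    module
  -- The normal part of the trace `H` of the covariant second derivative.
  set n := H + (-(euclInner H (L w₁) / ξ ^ 2)) • L w₁ + (-(euclInner H (L w₂) / ξ ^ 2)) • L w₂
    with hn
  have hn1 : euclInner (L w₁) n = 0 := by
    rw [hn]
    simp only [euclInner_add_right, euclInner_smul_right, h11, h12, euclInner_comm (L w₁) H]
    field_simp; ring
  have hn2 : euclInner (L w₂) n = 0 := by
    rw [hn]
    simp only [euclInner_add_right, euclInner_smul_right, h22, euclInner_comm (L w₂) (L w₁), h12,
      euclInner_comm (L w₂) H]
    field_simp; ring
  have hppos : p ≠ 0 := by rw [hp]; positivity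
  have hqpos : q ≠ 0 := by rw [hq]; positivity
  have hn0 : euclInner (L e₀) n = 0 := by
    rw [hLw₁, euclInner_smul_left] at hn1
    exact (mul_eq_zero.mp hn1).resolve_left hppos
  have hn1' : euclInner (L e₁) n = 0 := by
    rw [hLw₂, euclInner_add_left, euclInner_smul_left, euclInner_smul_left, hn0, mul_zero,
      zero_add] at hn2
    exact (mul_eq_zero.mp hn2).resolve_left (mul_ne_zero hEpos.ne' hqpos)
  have hmc := hmin n (by
    intro i
    fin_cases i
    · change euclInner (L e₀) n / ξ ^ 2 = 0
      rw [hn0, zero_div]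
    · change euclInner (L e₁) n / ξ ^ 2 = 0
      rw [hn1', zero_div])
  have hHn : euclInner H n = 0 := by
    have h3 : meanCurvature u n a = (G * (euclInner (C e₀ e₀) n / ξ ^ 2) -
        2 * F * (euclInner (C e₀ e₁) n / ξ ^ 2) + E * (euclInner (C e₁ e₁) n / ξ ^ 2)) /
          (2 * Δ) := by
      simp only [meanCurvature, secondForm, hcov]
      rfl
    rw [h3] at hmc
    rw [hHe, euclInner_add_left, euclInner_add_left, euclInner_smul_left, euclInner_smul_left,
      euclInner_smul_left]
    have h4 : G / Δ * euclInner (C e₀ e₀) n + -2 * F / Δ * euclInner (C e₀ e₁) n +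
        E / Δ * euclInner (C e₁ e₁) n = 2 * ξ ^ 2 * ((G * (euclInner (C e₀ e₀) n / ξ ^ 2) -
        2 * F * (euclInner (C e₀ e₁) n / ξ ^ 2) + E * (euclInner (C e₁ e₁) n / ξ ^ 2)) /
          (2 * Δ)) := by
      field_simp; ring
    rw [h4, hmc, mul_zero]
  have hnn : n = 0 := by
    by_contra hcon
    have h5 := euclInner_self_pos hcon
    have h6 : euclInner n n = 0 := by
      conv_lhs => rw [hn]
      rw [euclInner_add_left, euclInner_add_left, euclInner_smul_left, euclInner_smul_left, hHn,
        hn1, hn2]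
      ring
    exact h5.ne' h6
  refine ⟨w₁, w₂, euclInner H (L w₁) / ξ ^ 2, euclInner H (L w₂) / ξ ^ 2, h11, h22, h12, ?_⟩
  rw [hQw, hQw]
  have h7 : H = (euclInner H (L w₁) / ξ ^ 2) • L w₁ + (euclInner H (L w₂) / ξ ^ 2) • L w₂ := by
    have : H = n + ((euclInner H (L w₁) / ξ ^ 2) • L w₁ + (euclInner H (L w₂) / ξ ^ 2) • L w₂) := by
      rw [hn]; module
    rwa [hnn, zero_add] at this
  rw [← h7, hH]
  simp only [hC]
  abel

variable {S : Type*} [TopologicalSpace S] [ChartedSpace Plane S] {F : S → ℂ × ℝ}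

theorem IsProperMinimalImmersion.contDiffAt [IsManifold (𝓡 2) ∞ S]
    (hF : IsProperMinimalImmersion F) (s : S) :
    ContDiffAt ℝ 2 (F ∘ (chartAt Plane s).symm) (chartAt Plane s s) := by
  have h1 : ContMDiffOn (𝓡 2) 𝓘(ℝ, ℂ × ℝ) ∞ (F ∘ (chartAt Plane s).symm)
      (chartAt Plane s).target :=
    hF.smooth.comp_contMDiffOn (contMDiffOn_chart_symm (I := 𝓡 2) (n := ∞) (x := s))
  have h2 := (contMDiffOn_iff_contDiffOn.mp h1).contDiffAt
    ((chartAt Plane s).open_target.mem_nhds (mem_chart_target Plane s))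
  exact h2.of_le (WithTop.coe_le_coe.mpr le_top)

theorem IsProperMinimalImmersion.injective_fderiv
    (hF : IsProperMinimalImmersion F) (s : S) :
    Function.Injective (fderiv ℝ (F ∘ (chartAt Plane s).symm) (chartAt Plane s s)) := by
  have h := hF.immersion s
  have hd : MDifferentiableAt (𝓡 2) 𝓘(ℝ, ℂ × ℝ) F s := hF.smooth.mdifferentiable (by simp) s
  rw [hd.mfderiv] at h
  simp only [writtenInExtChartAt, mfld_simps, fderivWithin_univ] at h
  have e : (chartAt (ℂ × ℝ) (F s)) ∘ F ∘ (chartAt Plane s).symm = F ∘ (chartAt Plane s).symm := rfl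
  exact e ▸ h

end Frames

/-! ### Points of tangency -/

/-- First and second order conditions at a zero of the nonnegative function
`|u₁ - Z u₂|² + ξ² |u₂|² - κ (r² - |ζ|²) ξ`, along a curve in the half-space coupled with a line in
the disk. -/
theorem variation_of_curve {u₁ u₂ : ℂ → ℂ} {ζ : ℂ} (hu₁ : AnalyticAt ℂ u₁ ζ)
    (hu₂ : AnalyticAt ℂ u₂ ζ) {κ r : ℝ} {X : ℝ → ℂ × ℝ} {x v A : ℂ × ℝ} (hX : HasJet X x v A)
    (h : ℂ) {y y' y'' b b' b'' : ℂ} (hy : y = u₁ ζ - x.1 * u₂ ζ)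
    (hy' : y' = deriv u₁ ζ - x.1 * deriv u₂ ζ)
    (hy'' : y'' = deriv (deriv u₁) ζ - x.1 * deriv (deriv u₂) ζ)
    (hb : b = u₂ ζ) (hb' : b' = deriv u₂ ζ) (hb'' : b'' = deriv (deriv u₂) ζ)
    (h0 : ‖y‖ ^ 2 + x.2 ^ 2 * ‖b‖ ^ 2 = κ * (r ^ 2 - ‖ζ‖ ^ 2) * x.2)
    (hT : ∀ᶠ τ in 𝓝 (0 : ℝ), κ * (r ^ 2 - ‖ζ + τ • h‖ ^ 2) * (X τ).2 ≤
      ‖u₁ (ζ + τ • h) - (X τ).1 * u₂ (ζ + τ • h)‖ ^ 2 + (X τ).2 ^ 2 * ‖u₂ (ζ + τ • h)‖ ^ 2) :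
    spaceVariation y b x.2 (κ * (r ^ 2 - ‖ζ‖ ^ 2)) v.1 v.2 +
      2 * ((conj y * y' + x.2 ^ 2 * conj b * b' + κ * x.2 * conj ζ) * h).re = 0 ∧
    0 ≤ secondVariation y y' y'' b b' b'' ζ x.2 κ (κ * (r ^ 2 - ‖ζ‖ ^ 2)) v.1 v.2 A.1 A.2 h := by
  have j₁ := HasJet.of_analyticAt hu₁ h
  have j₂ := HasJet.of_analyticAt hu₂ h
  have jZ : HasJet (fun τ => (X τ).1) x.1 v.1 A.1 := hX.clm (ContinuousLinearMap.fst ℝ ℂ ℝ)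
  have jξ : HasJet (fun τ => (X τ).2) x.2 v.2 A.2 := hX.clm (ContinuousLinearMap.snd ℝ ℂ ℝ)
  have jξc : HasJet (fun τ => ((X τ).2 : ℂ)) (x.2 : ℂ) (v.2 : ℂ) (A.2 : ℂ) :=
    jξ.clm Complex.ofRealCLM
  have jζ : HasJet (fun τ : ℝ => ζ + τ • h) ζ h 0 := HasJet.line ζ h
  have jT := (((j₁.sub (jZ.mul j₂)).sq_norm).add ((jξc.mul j₂).sq_norm)).sub
    (((HasJet.const κ).mul ((HasJet.const (r ^ 2)).sub jζ.sq_norm)).mul jξ)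
  have e0 : ‖u₁ ζ - x.1 * u₂ ζ‖ ^ 2 + ‖(x.2 : ℂ) * u₂ ζ‖ ^ 2 -
      κ * (r ^ 2 - ‖ζ‖ ^ 2) * x.2 = 0 := by
    rw [norm_mul, Complex.norm_real, mul_pow, Real.norm_eq_abs, sq_abs, ← hy, ← hb, h0, sub_self]
  have jT' := jT.congr (fun τ => rfl) e0 rfl rfl
  obtain ⟨f1, f2⟩ := jT'.of_nonneg (by
    filter_upwards [hT] with τ hτ
    rw [norm_mul (((X τ).2 : ℝ) : ℂ), Complex.norm_real, mul_pow, Real.norm_eq_abs, sq_abs]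
    linarith)
  constructor
  · rw [← f1]
    subst hy hy' hb hb'
    simp only [spaceVariation, ← Complex.normSq_eq_norm_sq, Complex.normSq_apply]
    simp only [Complex.mul_re, Complex.mul_im, Complex.add_re, Complex.add_im, Complex.sub_re,
      Complex.sub_im, Complex.conj_re, Complex.conj_im, Complex.ofReal_re, Complex.ofReal_im,
      pow_two]
    ring
  · refine f2.trans_eq ?_
    subst hy hy' hy'' hb hb' hb''
    have x1 : deriv u₁ ζ * h - (v.1 * u₂ ζ + x.1 * (deriv u₂ ζ * h)) =
      (deriv u₁ ζ - x.1 * deriv u₂ ζ) * h - v.1 * u₂ ζ := by ring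
    have x2 : deriv (deriv u₁) ζ * h ^ 2 - (A.1 * u₂ ζ + 2 * (v.1 * (deriv u₂ ζ * h)) +
        x.1 * (deriv (deriv u₂) ζ * h ^ 2)) =
      (deriv (deriv u₁) ζ - x.1 * deriv (deriv u₂) ζ) * h ^ 2 - A.1 * u₂ ζ -
        2 * (v.1 * (deriv u₂ ζ * h)) := by ring
    rw [x1, x2, secondVariation]
    simp only [mul_zero, Complex.zero_re]
    ring

/-- The kernel of a proper minimal immersion, weighted with the hyperbolic metric of the disk of
radius `r`, has no interior maximum with value greater than `1`. -/
theorem le_one_of_isMax {f : ℂ → Sphere} {Ω : Set Sphere} (hf : IsConformalOnto f Ω)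
    {S : Type*} [TopologicalSpace S] [ChartedSpace Plane S] [IsManifold (𝓡 2) ∞ S]
    {F : S → ℂ × ℝ} (hF : IsProperMinimalImmersion F) {r m : ℝ} (hr : 0 < r) {s : S} {ζ : ℂ}
    (hζ : ζ ∈ disk) (hζr : ‖ζ‖ < r)
    (hm : (r ^ 2 - ‖ζ‖ ^ 2) / r * horoKernel f (F s) ζ = m)
    (hmax : ∀ s' : S, ∀ w : ℂ, ‖w‖ ≤ r →
      (r ^ 2 - ‖w‖ ^ 2) / r * horoKernel f (F s') w ≤ m) : m ≤ 1 := by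
  by_contra! hm1
  obtain ⟨u₁, u₂, hu₁, hu₂, hW, hker, -⟩ := hf.exists_lift hζ
  set x := F s with hx
  have hxpos : 0 < x.2 := hF.mem_H3 s
  set κ := 1 / (r * m) with hκ
  have hm0 : 0 < m := by linarith
  have hWne : ∀ᶠ w in 𝓝 ζ, u₁ w ≠ 0 ∨ u₂ w ≠ 0 := by
    have : u₁ ζ ≠ 0 ∨ u₂ ζ ≠ 0 := by
      by_contra! hc
      rw [hc.1, hc.2] at hW
      simp at hW
    rcases this with h | h
    · exact (hu₁.continuousAt.eventually_ne h).mono fun w hw => Or.inl hw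
    · exact (hu₂.continuousAt.eventually_ne h).mono fun w hw => Or.inr hw
  have hform : ∀ᶠ w in 𝓝 ζ, ∀ x' ∈ H3, 0 < ‖u₁ w - x'.1 * u₂ w‖ ^ 2 + x'.2 ^ 2 * ‖u₂ w‖ ^ 2 := by
    filter_upwards [hWne] with w hw x' hx'
    have hx2 : 0 < x'.2 := hx'
    by_cases h2 : u₂ w = 0
    · have h1 : u₁ w ≠ 0 := by tauto
      simp only [h2, mul_zero, sub_zero, norm_zero]
      positivity
    · positivity
  have hcmp : ∀ᶠ w in 𝓝 ζ, ∀ s' : S, κ * (r ^ 2 - ‖w‖ ^ 2) * (F s').2 ≤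
      ‖u₁ w - (F s').1 * u₂ w‖ ^ 2 + (F s').2 ^ 2 * ‖u₂ w‖ ^ 2 := by
    have hball : ∀ᶠ w in 𝓝 ζ, ‖w‖ < r := continuous_norm.continuousAt.eventually_lt_const hζr
    filter_upwards [hker, hform, hball] with w hw1 hw2 hw3 s'
    have h1 := hmax s' w hw3.le
    rw [hw1 _ (hF.mem_H3 s')] at h1
    have h2 := hw2 _ (hF.mem_H3 s')
    set P := ‖u₁ w - (F s').1 * u₂ w‖ ^ 2 + (F s').2 ^ 2 * ‖u₂ w‖ ^ 2
    have e : κ * (r ^ 2 - ‖w‖ ^ 2) * (F s').2 =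
        (r ^ 2 - ‖w‖ ^ 2) / r * ((F s').2 / P) * (P / m) := by rw [hκ]; field_simp
    rw [e]
    calc _ ≤ m * (P / m) := mul_le_mul_of_nonneg_right h1 (by positivity)
      _ = P := by field_simp
  have h0 : ‖u₁ ζ - x.1 * u₂ ζ‖ ^ 2 + x.2 ^ 2 * ‖u₂ ζ‖ ^ 2 = κ * (r ^ 2 - ‖ζ‖ ^ 2) * x.2 := by
    have h2 := hform.self_of_nhds x hxpos
    rw [hker.self_of_nhds x hxpos] at hm
    rw [hκ, ← hm]
    have h3 : r ^ 2 - ‖ζ‖ ^ 2 ≠ 0 := by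
      have := norm_nonneg ζ
      nlinarith
    field_simp
  set u := F ∘ (chartAt Plane s).symm with hu
  set a := chartAt Plane s s with ha
  have hua : u a = x := by simp [hu, ha, hx]
  have hcd : ContDiffAt ℝ 2 u a := hF.contDiffAt s
  obtain ⟨w₁, w₂, α, β, h11, h22, h12, hmean⟩ := exists_frame_of_meanCurvature_eq_zero hcd
    (hF.injective_fderiv s) (by rw [hua]; exact hxpos) (by
      intro n hn
      refine hF.minimal s n ?_
      intro i
      have := hn i
      rwa [hua] at this)
  rw [hua] at h11 h22 hmean
  have hvar := fun (w : Plane) (h : ℂ) => by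
    have hjet := HasJet.of_contDiffAt hcd w
    rw [hua] at hjet
    refine variation_of_curve hu₁ hu₂ (κ := κ) (r := r) hjet h rfl rfl rfl rfl rfl rfl h0 ?_
    have ht : Tendsto (fun τ : ℝ => ζ + τ • h) (𝓝 0) (𝓝 ζ) := by
      have : Continuous fun τ : ℝ => ζ + τ • h := by fun_prop
      simpa using this.tendsto 0
    exact (ht.eventually hcmp).mono fun τ hτ => hτ _
  set v₁ := fderiv ℝ u a w₁
  set v₂ := fderiv ℝ u a w₂
  set A₁ := fderiv ℝ (fun b => fderiv ℝ u b w₁) a w₁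
  set A₂ := fderiv ℝ (fun b => fderiv ℝ u b w₂) a w₂
  have hN₁ := (hvar w₁ 0).1
  have hN₂ := (hvar w₂ 0).1
  simp only [mul_zero, Complex.zero_re, add_zero] at hN₁ hN₂
  set y := u₁ ζ - x.1 * u₂ ζ with hy
  set y' := deriv u₁ ζ - x.1 * deriv u₂ ζ with hy'
  set g := conj y * y' + x.2 ^ 2 * conj (u₂ ζ) * deriv u₂ ζ + κ * x.2 * conj ζ with hg
  have hg0 : g = 0 := by
    have h1 := (hvar w₁ (conj g)).1
    rw [hN₁, zero_add, Complex.mul_conj, Complex.ofReal_re] at h1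
    simpa using h1
  have hcrit : conj y * y' + x.2 ^ 2 * conj (u₂ ζ) * deriv u₂ ζ = -(κ * x.2 * conj ζ) := by
    linear_combination hg0
  have hW' : ‖y * deriv u₂ ζ - y' * u₂ ζ‖ = 1 := by
    rw [← hW, hy, hy']; congr 1; ring
  have hm1' := congrArg Prod.fst hmean
  have hm2' := congrArg Prod.snd hmean
  simp only [christoffel, h11, h22, Prod.fst_add, Prod.snd_add, Prod.smul_fst, Prod.smul_snd,
    Prod.fst_neg, Prod.snd_neg, Prod.fst_sub, Prod.snd_sub, Complex.real_smul, smul_eq_mul]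
    at hm1' hm2'
  have hfin := one_le_sq_of_secondVariation_nonneg (r := r) (α := α) (β := β)
    (W₁ := A₁.1) (W₂ := A₂.1) (σ₁ := A₁.2) (σ₂ := A₂.2) hxpos h0 hW' hcrit hN₁ hN₂
    (by rw [← euclInner_self, h11]) (by rw [← euclInner_self, h22])
    (by
      rw [← h12]
      simp only [euclInner, Complex.mul_re, Complex.conj_re, Complex.conj_im]
      ring)
    (by
      push_cast at hm1'
      linear_combination hm1')
    (by
      have : 1 / x.2 * x.2 ^ 2 = x.2 := by field_simp
      linear_combination hm2' - 2 * this)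
    (fun k₁ k₂ => add_nonneg (hvar w₁ k₁).2 (hvar w₂ k₂).2)
  have hκr : κ * r = 1 / m := by rw [hκ]; field_simp
  rw [hκr] at hfin
  have : 1 / m < 1 := by rw [div_lt_one hm0]; exact hm1
  have h3 : 0 < 1 / m := by positivity
  nlinarith

/-! ### The ideal boundary and compactness -/

theorem mem_idealBoundary_coe {A : Set (ℂ × ℝ)} {z : ℂ} :
    (z : Sphere) ∈ idealBoundary A ↔ (z, (0 : ℝ)) ∈ closure A := by
  rw [OnePoint.isOpenEmbedding_coe.isInducing.closure_eq_preimage_closure_image]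
  rfl

theorem mem_idealBoundary_infty {A : Set (ℂ × ℝ)} :
    (OnePoint.infty : Sphere) ∈ idealBoundary A ↔ ∀ R : ℝ, ∃ x ∈ A, R < ‖x‖ := by
  change (OnePoint.infty : OnePoint (ℂ × ℝ)) ∈ closure _ ↔ _
  rw [mem_closure_iff_nhds_basis OnePoint.hasBasis_nhds_infty]
  constructor
  · intro h R
    obtain ⟨p, ⟨x, hx, rfl⟩, hp⟩ := h (Metric.closedBall 0 R)
      ⟨Metric.isClosed_closedBall, isCompact_closedBall 0 R⟩
    refine ⟨x, hx, ?_⟩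
    rcases hp with ⟨x', hx', e⟩ | hp
    · rw [← OnePoint.coe_injective e]
      simpa using hx'
    · exact absurd hp (by simp)
  · rintro h s ⟨-, hs⟩
    obtain ⟨R, hR⟩ := hs.isBounded.subset_closedBall 0
    obtain ⟨x, hx, hxR⟩ := h R
    refine ⟨x, ⟨x, hx, rfl⟩, Or.inl ⟨x, fun hxs => ?_, rfl⟩⟩
    have := hR hxs
    simp at this
    linarith

theorem isCompact_truncation (R ε : ℝ) :
    IsCompact {x : ℂ × ℝ | ‖x‖ ≤ R ∧ ε ≤ x.2} := by
  have : {x : ℂ × ℝ | ‖x‖ ≤ R ∧ ε ≤ x.2} = Metric.closedBall 0 R ∩ {x | ε ≤ x.2} := by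
    ext x; simp
  rw [this]
  exact (isCompact_closedBall 0 R).inter_right (isClosed_le continuous_const continuous_snd)

/-- The points of `M` in horoballs of definite size based near a point of the sphere that is not
in the ideal boundary of `M` stay in a compact subset of the half-space. -/
theorem exists_isCompact_of_not_mem_idealBoundary {f : ℂ → Sphere} {Ω : Set Sphere}
    (hf : IsConformalOnto f Ω) {ζ : ℂ} (hζ : ζ ∈ disk) {M : Set (ℂ × ℝ)} (hM : M ⊆ H3)
    (hfM : f ζ ∉ idealBoundary M) :
    ∃ V ∈ 𝓝 ζ, ∃ L ⊆ H3, IsCompact L ∧ ∀ w ∈ V, ∀ x ∈ M, 1 ≤ horoKernel f x w → x ∈ L := by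
  obtain ⟨u₁, u₂, hu₁, hu₂, hW, hker, hcase⟩ := hf.exists_lift hζ
  -- In terms of the lift, `x = (Z, ξ)` lies in the horoball if and only if
  -- `|u₁ - Z u₂|² + ξ² |u₂|² ≤ ξ`.
  have hform : ∀ w, (∀ x ∈ H3,
      horoKernel f x w = x.2 / (‖u₁ w - x.1 * u₂ w‖ ^ 2 + x.2 ^ 2 * ‖u₂ w‖ ^ 2)) →
      ∀ x ∈ M, 1 ≤ horoKernel f x w → ‖u₁ w - x.1 * u₂ w‖ ^ 2 + x.2 ^ 2 * ‖u₂ w‖ ^ 2 ≤ x.2 := by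
    intro w hw x hx h1
    rw [hw x (hM hx)] at h1
    rcases (show 0 ≤ ‖u₁ w - x.1 * u₂ w‖ ^ 2 + x.2 ^ 2 * ‖u₂ w‖ ^ 2 by
      positivity).eq_or_lt with h0 | h0
    · rw [← h0, div_zero] at h1; linarith
    · rwa [one_le_div h0] at h1
  rcases hcase with ⟨hinf, h2⟩ | ⟨z, hz, h1⟩
  · rw [hinf, mem_idealBoundary_infty] at hfM
    push Not at hfM
    obtain ⟨R, hR⟩ := hfM
    have h1 : u₁ ζ ≠ 0 := by
      intro h1
      rw [h1, h2] at hW; simp at hW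
    have hcont : ContinuousAt (fun w => ‖u₁ w‖ - |R| * ‖u₂ w‖) ζ :=
      hu₁.continuousAt.norm.sub (continuousAt_const.mul hu₂.continuousAt.norm)
    have hc : ∀ᶠ w in 𝓝 ζ, ‖u₁ ζ‖ / 2 < ‖u₁ w‖ - |R| * ‖u₂ w‖ := by
      refine hcont.eventually_const_lt ?_
      beta_reduce
      rw [h2, norm_zero, mul_zero, sub_zero]
      have := norm_pos_iff.mpr h1
      linarith
    refine ⟨_, hc.and hker, {x | ‖x‖ ≤ R ∧ (‖u₁ ζ‖ / 2) ^ 2 ≤ x.2}, ?_, isCompact_truncation _ _,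
      ?_⟩
    · rintro x ⟨-, hx⟩
      have := norm_pos_iff.mpr h1
      exact lt_of_lt_of_le (by positivity) hx
    · rintro w ⟨hw, hwk⟩ x hx hK
      have h3 := hform w hwk x hx hK
      refine ⟨hR x hx, ?_⟩
      have h4 : ‖x.1‖ ≤ |R| := (norm_fst_le x).trans ((hR x hx).trans (le_abs_self R))
      have h5 : ‖u₁ w‖ - |R| * ‖u₂ w‖ ≤ ‖u₁ w - x.1 * u₂ w‖ := by
        refine le_trans ?_ (norm_sub_norm_le _ _)
        rw [norm_mul]
        have := mul_le_mul_of_nonneg_right h4 (norm_nonneg (u₂ w))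
        linarith
      have h6 : ‖u₁ ζ‖ / 2 ≤ ‖u₁ w - x.1 * u₂ w‖ := hw.le.trans h5
      have h7 : (‖u₁ ζ‖ / 2) ^ 2 ≤ ‖u₁ w - x.1 * u₂ w‖ ^ 2 :=
        pow_le_pow_left₀ (by positivity) h6 2
      have : 0 ≤ x.2 ^ 2 * ‖u₂ w‖ ^ 2 := by positivity
      linarith
  · rw [hz, mem_idealBoundary_coe, Metric.mem_closure_iff] at hfM
    push Not at hfM
    obtain ⟨δ, hδ, hfar⟩ := hfM
    have h2 : u₂ ζ ≠ 0 := by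
      intro h2
      rw [h2, mul_zero] at h1
      rw [h1, h2] at hW; simp at hW
    set c := ‖u₂ ζ‖ / 2 with hc
    have hcpos : 0 < c := by have := norm_pos_iff.mpr h2; positivity
    have e1 : ∀ᶠ w in 𝓝 ζ, c < ‖u₂ w‖ :=
      hu₂.continuousAt.norm.eventually_const_lt (by
        have := norm_pos_iff.mpr h2
        rw [hc]; linarith)
    have e2 : ∀ᶠ w in 𝓝 ζ, ‖u₁ w / u₂ w - z‖ < δ / 2 := by
      have hcont : ContinuousAt (fun w => ‖u₁ w / u₂ w - z‖) ζ :=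
        ((hu₁.continuousAt.div hu₂.continuousAt h2).sub continuousAt_const).norm
      refine hcont.eventually_lt_const ?_
      beta_reduce
      rw [h1, mul_div_cancel_right₀ _ h2, sub_self, norm_zero]
      positivity
    set ε := min δ (c ^ 2 * δ ^ 2 / 4) with hε
    have hεpos : 0 < ε := by positivity
    set B := 1 / c ^ 2 with hB
    have hBpos : 0 < B := by positivity
    refine ⟨_, e1.and (e2.and hker), {x | ‖x‖ ≤ ‖z‖ + δ / 2 + B ∧ ε ≤ x.2}, ?_,
      isCompact_truncation _ _, ?_⟩
    · rintro x ⟨-, hx⟩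
      exact lt_of_lt_of_le hεpos hx
    · rintro w ⟨hw1, hw2, hwk⟩ x hx hK
      have h3 := hform w hwk x hx hK
      have hxpos : 0 < x.2 := hM hx
      have hu2 : u₂ w ≠ 0 := norm_pos_iff.mp (hcpos.trans hw1)
      have hc2 : c ^ 2 ≤ ‖u₂ w‖ ^ 2 := pow_le_pow_left₀ hcpos.le hw1.le 2
      have h4 : ‖u₁ w - x.1 * u₂ w‖ ^ 2 = ‖u₁ w / u₂ w - x.1‖ ^ 2 * ‖u₂ w‖ ^ 2 := by
        rw [← mul_pow, ← norm_mul, sub_mul, div_mul_cancel₀ _ hu2]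
      rw [h4] at h3
      have h5 : (‖u₁ w / u₂ w - x.1‖ ^ 2 + x.2 ^ 2) * c ^ 2 ≤ x.2 := by
        refine le_trans ?_ h3
        rw [← add_mul]
        exact mul_le_mul_of_nonneg_left hc2 (by positivity)
      set d := ‖u₁ w / u₂ w - x.1‖ with hd
      have hd0 : 0 ≤ d := norm_nonneg _
      have h6 : d ^ 2 + x.2 ^ 2 ≤ x.2 * B := by
        rw [hB, mul_one_div, le_div_iff₀ (by positivity)]
        exact h5
      have h7 : x.2 ≤ B := by nlinarith
      have h8 : d ≤ B := by nlinarith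
      have h9 : ‖x.1 - z‖ ≤ d + δ / 2 := by
        have : x.1 - z = -(u₁ w / u₂ w - x.1) + (u₁ w / u₂ w - z) := by ring
        rw [this]
        refine (norm_add_le _ _).trans ?_
        rw [norm_neg]
        linarith
      constructor
      · rw [Prod.norm_def]
        refine max_le ?_ ?_
        · have : ‖x.1‖ ≤ ‖x.1 - z‖ + ‖z‖ := by
            simpa using norm_add_le (x.1 - z) z
          linarith
        · rw [Real.norm_eq_abs, abs_of_pos hxpos]
          have := norm_nonneg z
          linarith
      · by_contra! hlt
        have hl1 : x.2 < δ := hlt.trans_le (min_le_left _ _)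
        have hl2 : x.2 < c ^ 2 * δ ^ 2 / 4 := hlt.trans_le (min_le_right _ _)
        have h10 : d < δ / 2 := by
          have : d ^ 2 * c ^ 2 < (δ / 2) ^ 2 * c ^ 2 := by nlinarith [sq_nonneg (x.2 * c)]
          have := lt_of_mul_lt_mul_right this (by positivity)
          exact lt_of_pow_lt_pow_left₀ 2 (by positivity) this
        have h11 := hfar x hx
        rw [Prod.dist_eq] at h11
        rcases le_max_iff.mp h11 with h | h
        · rw [dist_comm, dist_eq_norm] at h
          linarith
        · rw [dist_comm, Real.dist_eq] at h
          simp only [sub_zero, abs_of_pos hxpos] at h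
          linarith

/-- A proper minimal surface whose ideal boundary misses `Ω` does not meet the open horoballs
determined by the hyperbolic metric of `Ω`. -/
theorem horoKernel_mul_le_one {f : ℂ → Sphere} {Ω : Set Sphere} (hf : IsConformalOnto f Ω)
    {S : Type*} [TopologicalSpace S] [ChartedSpace Plane S] [IsManifold (𝓡 2) ∞ S]
    {F : S → ℂ × ℝ} (hF : IsProperMinimalImmersion F)
    (hfM : ∀ p ∈ Ω, p ∉ idealBoundary (range F)) {ζ : ℂ} (hζ : ζ ∈ disk) (s : S) :
    (1 - ‖ζ‖ ^ 2) * horoKernel f (F s) ζ ≤ 1 := by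
  have hMH : range F ⊆ H3 := by rintro _ ⟨s, rfl⟩; exact hF.mem_H3 s
  have hker0 : ∀ (s : S) (w : ℂ), 0 ≤ horoKernel f (F s) w := by
    intro s w
    have : 0 < (F s).2 := hF.mem_H3 s
    unfold horoKernel
    split_ifs <;> positivity
  have hζ1 : ‖ζ‖ < 1 := by simpa [disk] using hζ
  -- It suffices to treat the disks of radius `r < 1`.
  suffices H : ∀ r : ℝ, ‖ζ‖ < r → r < 1 → (r ^ 2 - ‖ζ‖ ^ 2) / r * horoKernel f (F s) ζ ≤ 1 by
    have hcont : ContinuousAt (fun r : ℝ => (r ^ 2 - ‖ζ‖ ^ 2) / r * horoKernel f (F s) ζ) 1 := by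
      refine ContinuousAt.mul (ContinuousAt.div ?_ continuousAt_id one_ne_zero) continuousAt_const
      fun_prop
    have ht := hcont.tendsto.mono_left (nhdsWithin_le_nhds (s := Iio 1))
    simp only [one_pow, div_one] at ht
    refine le_of_tendsto ht ?_
    filter_upwards [Ioo_mem_nhdsLT hζ1] with r hr using H r hr.1 hr.2
  intro r hζr hr1
  have hr : 0 < r := (norm_nonneg ζ).trans_lt hζr
  by_contra! hgt
  have hsub : Metric.closedBall (0 : ℂ) r ⊆ disk := Metric.closedBall_subset_ball hr1
  obtain ⟨L, hLH, hLc, hL⟩ : ∃ L ⊆ H3, IsCompact L ∧ ∀ w ∈ Metric.closedBall (0 : ℂ) r,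
      ∀ x ∈ range F, 1 ≤ horoKernel f x w → x ∈ L := by
    refine (isCompact_closedBall (0 : ℂ) r).induction_on (p := fun V => ∃ L ⊆ H3, IsCompact L ∧
      ∀ w ∈ V, ∀ x ∈ range F, 1 ≤ horoKernel f x w → x ∈ L) ?_ ?_ ?_ ?_
    · exact ⟨∅, empty_subset _, isCompact_empty, fun w hw => hw.elim⟩
    · rintro V V' hV ⟨L, h1, h2, h3⟩
      exact ⟨L, h1, h2, fun w hw => h3 w (hV hw)⟩
    · rintro V V' ⟨L, h1, h2, h3⟩ ⟨L', h1', h2', h3'⟩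
      refine ⟨L ∪ L', union_subset h1 h1', h2.union h2', ?_⟩
      rintro w (hw | hw) x hx hK
      · exact Or.inl (h3 w hw x hx hK)
      · exact Or.inr (h3' w hw x hx hK)
    · intro w hw
      have hfw : f w ∉ idealBoundary (range F) :=
        hfM _ (hf.image_eq ▸ mem_image_of_mem f (hsub hw))
      obtain ⟨V, hV, L, h1, h2, h3⟩ :=
        exists_isCompact_of_not_mem_idealBoundary hf (hsub hw) hMH hfw
      exact ⟨V, mem_nhdsWithin_of_mem_nhds hV, L, h1, h2, h3⟩
  have hcpt : IsCompact ((F ⁻¹' L) ×ˢ Metric.closedBall (0 : ℂ) r) :=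
    (hF.proper L hLH hLc).prod (isCompact_closedBall 0 r)
  have hout : ∀ (s' : S) (w : ℂ), ‖w‖ ≤ r → F s' ∉ L →
      (r ^ 2 - ‖w‖ ^ 2) / r * horoKernel f (F s') w ≤ 1 := by
    intro s' w hw hs'
    have h1 : horoKernel f (F s') w < 1 := by
      by_contra! h
      exact hs' (hL w (by simpa using hw) _ (mem_range_self s') h)
    have h2 : (r ^ 2 - ‖w‖ ^ 2) / r ≤ 1 := by
      rw [div_le_one hr]; nlinarith [sq_nonneg ‖w‖]
    have h3 : 0 ≤ (r ^ 2 - ‖w‖ ^ 2) / r :=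
      div_nonneg (by nlinarith [norm_nonneg w]) hr.le
    exact mul_le_one₀ h2 (hker0 s' w) h1.le
  have hFc : Continuous F := hF.smooth.continuous
  have hcont : ContinuousOn (fun q : S × ℂ => (r ^ 2 - ‖q.2‖ ^ 2) / r * horoKernel f (F q.1) q.2)
      ((F ⁻¹' L) ×ˢ Metric.closedBall (0 : ℂ) r) := by
    rintro ⟨s', w⟩ ⟨-, hw⟩
    refine ContinuousAt.continuousWithinAt ?_
    refine ContinuousAt.mul (by fun_prop) ?_
    obtain ⟨u₁, u₂, hu₁, hu₂, hW, hker, -⟩ := hf.exists_lift (hsub hw)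
    have e : (fun q : S × ℂ => horoKernel f (F q.1) q.2) =ᶠ[𝓝 (s', w)] fun q =>
        (F q.1).2 / (‖u₁ q.2 - (F q.1).1 * u₂ q.2‖ ^ 2 + (F q.1).2 ^ 2 * ‖u₂ q.2‖ ^ 2) := by
      filter_upwards [continuousAt_snd.eventually hker] with q hq using hq _ (hF.mem_H3 _)
    refine ContinuousAt.congr ?_ e.symm
    have c1 : ContinuousAt (fun q : S × ℂ => u₁ q.2) (s', w) :=
      ContinuousAt.comp (f := Prod.snd) (x := (s', w)) hu₁.continuousAt continuousAt_snd
    have c2 : ContinuousAt (fun q : S × ℂ => u₂ q.2) (s', w) :=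
      ContinuousAt.comp (f := Prod.snd) (x := (s', w)) hu₂.continuousAt continuousAt_snd
    have c3 : ContinuousAt (fun q : S × ℂ => (F q.1).1) (s', w) := by fun_prop
    have c4 : ContinuousAt (fun q : S × ℂ => (F q.1).2) (s', w) := by fun_prop
    refine c4.div (((c1.sub (c3.mul c2)).norm.pow 2).add ((c4.pow 2).mul (c2.norm.pow 2))) ?_
    have hx2 : 0 < (F s').2 := hF.mem_H3 s'
    by_cases h2 : u₂ w = 0
    · have h1 : u₁ w ≠ 0 := by
        intro h1
        rw [h1, h2] at hW; simp at hW
      simp only [h2, mul_zero, sub_zero, norm_zero]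
      positivity
    · positivity
  have hmem : (s, ζ) ∈ (F ⁻¹' L) ×ˢ Metric.closedBall (0 : ℂ) r := by
    refine ⟨?_, by simpa using hζr.le⟩
    by_contra h
    exact absurd (hout s ζ hζr.le h) (not_le.mpr hgt)
  obtain ⟨⟨s', w⟩, ⟨-, hw⟩, hmax⟩ := hcpt.exists_isMaxOn ⟨_, hmem⟩ hcont
  have hgt' : 1 < (r ^ 2 - ‖w‖ ^ 2) / r * horoKernel f (F s') w := hgt.trans_le (hmax hmem)
  have hwr : ‖w‖ ≤ r := by simpa using hw
  have hwr' : ‖w‖ < r := by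
    refine lt_of_le_of_ne hwr fun h => ?_
    rw [h, sub_self, zero_div, zero_mul] at hgt'
    linarith
  refine absurd (le_one_of_isMax hf hF hr (hsub hw) hwr' rfl fun s'' w'' hw'' => ?_)
    (not_le.mpr hgt')
  by_cases h : F s'' ∈ L
  · exact hmax (show (s'', w'') ∈ _ from ⟨h, by simpa using hw''⟩)
  · exact (hout s'' w'' hw'' h).trans hgt'.le

/-! ### The component adjacent to the domain -/

theorem convex_H3 : Convex ℝ H3 := by
  have : H3 = (ContinuousLinearMap.snd ℝ ℂ ℝ) ⁻¹' Ioi 0 := rfl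
  rw [this]
  exact (convex_Ioi 0).affine_preimage (ContinuousLinearMap.snd ℝ ℂ ℝ).toLinearMap.toAffineMap

theorem idealBoundary_mono {A B : Set (ℂ × ℝ)} (h : A ⊆ B) : idealBoundary A ⊆ idealBoundary B :=
  fun _ hp => closure_mono (image_mono h) hp

/-- A point of the sphere outside the ideal boundary of `M` has a connected end neighborhood `W`
in the half-space that misses `M`: a half-ball, or the exterior of a half-ball. -/
theorem exists_endNeighborhood {M : Set (ℂ × ℝ)} {p : Sphere} (hp : p ∉ idealBoundary M) :
    ∃ W ⊆ H3 \ M, IsPreconnected W ∧ (∀ A ⊆ H3, p ∈ idealBoundary A → (A ∩ W).Nonempty) ∧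
      p ∈ interior (idealBoundary W) := by
  induction p using OnePoint.rec with
  | infty =>
    rw [mem_idealBoundary_infty] at hp
    push Not at hp
    obtain ⟨R₀, hR₀⟩ := hp
    set R := max R₀ 0 with hR
    have hRM : ∀ x ∈ M, ‖x‖ ≤ R := fun x hx => (hR₀ x hx).trans (le_max_left _ _)
    have hR0 : 0 ≤ R := le_max_right _ _
    refine ⟨{x | x ∈ H3 ∧ R < ‖x‖}, ?_, ?_, ?_, ?_⟩
    · exact fun x hx => ⟨hx.1, fun hxM => absurd (hRM x hxM) (not_le.mpr hx.2)⟩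
    · -- Every point of the set lies on a vertical ray that reaches the half-space `ξ > R`.
      have hP : Convex ℝ {x : ℂ × ℝ | R < x.2} :=
        (convex_Ioi R).affine_preimage (ContinuousLinearMap.snd ℝ ℂ ℝ).toLinearMap.toAffineMap
      have hPsub : {x : ℂ × ℝ | R < x.2} ⊆ {x | x ∈ H3 ∧ R < ‖x‖} := fun x hx => by
        have hx' : R < x.2 := hx
        exact ⟨hR0.trans_lt hx', hx'.trans_le ((le_abs_self _).trans (norm_snd_le x))⟩
      refine isPreconnected_of_forall ((0 : ℂ), R + 1) fun x hx => ?_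
      by_cases hx2 : R < x.2
      · exact ⟨_, hPsub, by simp, hx2, hP.isPreconnected⟩
      have hx1 : R < ‖x.1‖ := by
        have h1 := hx.2
        rw [Prod.norm_def, lt_max_iff] at h1
        refine h1.resolve_right fun h => hx2 ?_
        rwa [Real.norm_eq_abs, abs_of_pos hx.1] at h
      refine ⟨({x.1} ×ˢ Ioi 0) ∪ {x : ℂ × ℝ | R < x.2}, ?_, Or.inr (by simp), Or.inl ⟨rfl, hx.1⟩,
        ?_⟩
      · rintro y (⟨hy1, hy2⟩ | hy)
        · refine ⟨hy2, lt_of_lt_of_le ?_ (norm_fst_le y)⟩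
          rw [mem_singleton_iff.mp hy1]; exact hx1
        · exact hPsub hy
      · refine IsPreconnected.union (x.1, R + 1) ⟨rfl, ?_⟩ (by simp)
          (isPreconnected_singleton.prod isPreconnected_Ioi) hP.isPreconnected
        exact show (0 : ℝ) < R + 1 by linarith
    · intro A hA hpA
      obtain ⟨x, hx, hxR⟩ := mem_idealBoundary_infty.mp hpA R
      exact ⟨x, hx, hA hx, hxR⟩
    · rw [mem_interior_iff_mem_nhds]
      refine OnePoint.hasBasis_nhds_infty.mem_iff.mpr ⟨Metric.closedBall 0 R,
        ⟨Metric.isClosed_closedBall, isCompact_closedBall _ _⟩, ?_⟩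
      rintro q (⟨z, hz, rfl⟩ | hq)
      · rw [mem_idealBoundary_coe, Metric.mem_closure_iff]
        intro ε hε
        have hz' : R < ‖z‖ := by simpa using hz
        refine ⟨(z, ε / 2), ⟨by simpa [H3] using hε, hz'.trans_le (norm_fst_le (z, ε / 2))⟩, ?_⟩
        rw [Prod.dist_eq]
        simp only [dist_self, Real.dist_eq, zero_sub, abs_neg, abs_of_pos (half_pos hε)]
        exact max_lt hε (half_lt_self hε)
      · rw [mem_singleton_iff.mp hq, mem_idealBoundary_infty]
        intro R'
        refine ⟨(0, max R R' + 1), ⟨?_, ?_⟩, ?_⟩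
        · exact show 0 < max R R' + 1 from by have := le_max_left R R'; linarith
        · refine lt_of_lt_of_le ?_ ((le_abs_self _).trans (norm_snd_le (0, max R R' + 1)))
          have := le_max_left R R'
          simp only; linarith
        · refine lt_of_lt_of_le ?_ ((le_abs_self _).trans (norm_snd_le (0, max R R' + 1)))
          have := le_max_right R R'
          simp only; linarith
  | coe z =>
    rw [mem_idealBoundary_coe, Metric.mem_closure_iff] at hp
    push Not at hp
    obtain ⟨δ, hδ, hfar⟩ := hp
    refine ⟨Metric.ball (z, 0) δ ∩ H3, ?_, ?_, ?_, ?_⟩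
    · rintro x ⟨hx, hxH⟩
      refine ⟨hxH, fun hxM => ?_⟩
      have := hfar x hxM
      rw [Metric.mem_ball, dist_comm] at hx
      linarith
    · exact ((convex_ball _ _).inter convex_H3).isPreconnected
    · intro A hA hpA
      rw [mem_idealBoundary_coe, Metric.mem_closure_iff] at hpA
      obtain ⟨x, hx, hxd⟩ := hpA δ hδ
      exact ⟨x, hx, by rwa [Metric.mem_ball, dist_comm], hA hx⟩
    · rw [mem_interior_iff_mem_nhds, OnePoint.nhds_coe_eq, Filter.mem_map]
      refine mem_of_superset (Metric.ball_mem_nhds z hδ) fun z' hz' => ?_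
      rw [mem_preimage, mem_idealBoundary_coe, Metric.mem_closure_iff]
      intro ε hε
      have hm : 0 < min (ε / 2) (δ / 2) := by positivity
      refine ⟨(z', min (ε / 2) (δ / 2)), ⟨?_, hm⟩, ?_⟩
      · rw [Metric.mem_ball, Prod.dist_eq]
        simp only [Real.dist_eq, sub_zero, abs_of_pos hm]
        exact max_lt hz' ((min_le_right _ _).trans_lt (half_lt_self hδ))
      · rw [Prod.dist_eq]
        simp only [dist_self, Real.dist_eq, zero_sub, abs_neg, abs_of_pos hm]
        exact max_lt hε ((min_le_left _ _).trans_lt (half_lt_self hε))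

section Components

variable {X : Type*} [TopologicalSpace X] {A U V W : Set X}

theorem IsComponentOf.subset_of_inter_nonempty (hU : IsComponentOf U A)
    (hWA : W ⊆ A) (hW : IsPreconnected W) (h : (U ∩ W).Nonempty) : W ⊆ U := by
  obtain ⟨x, hx, rfl⟩ := hU
  obtain ⟨y, hyU, hyW⟩ := h
  rw [connectedComponentIn_eq hyU]
  exact hW.subset_connectedComponentIn hyW hWA

theorem IsComponentOf.eq_of_inter_nonempty (hU : IsComponentOf U A)
    (hV : IsComponentOf V A) (h : (U ∩ V).Nonempty) : U = V := by
  obtain ⟨x, hx, rfl⟩ := hU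
  obtain ⟨y, hy, rfl⟩ := hV
  obtain ⟨z, hz1, hz2⟩ := h
  rw [connectedComponentIn_eq hz1, connectedComponentIn_eq hz2]

theorem IsComponentOf.subset (hU : IsComponentOf U A) : U ⊆ A := by
  obtain ⟨x, hx, rfl⟩ := hU
  exact connectedComponentIn_subset A x

theorem IsComponentOf.nonempty (hU : IsComponentOf U A) : U.Nonempty := by
  obtain ⟨x, hx, rfl⟩ := hU
  exact ⟨x, mem_connectedComponentIn hx⟩

end Components

/-- Exactly one component of the complement of `M` is adjacent to a connected set `Ω` in the
complement of the ideal boundary of `M`. -/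
theorem existsUnique_component {Ω : Set Sphere} (hΩ : IsPreconnected Ω) (hne : Ω.Nonempty)
    {M : Set (ℂ × ℝ)} (hΩM : ∀ p ∈ Ω, p ∉ idealBoundary M) :
    ∃! U : Set (ℂ × ℝ), IsComponentOf U (H3 \ M) ∧ Ω ⊆ idealBoundary U := by
  choose! W hWsub hWc hWA hWi using fun p (hp : p ∈ Ω) => exists_endNeighborhood (hΩM p hp)
  have hWne : ∀ p ∈ Ω, ∀ q ∈ Ω, q ∈ idealBoundary (W p) → (W p ∩ W q).Nonempty :=
    fun p hp q hq h => hWA q hq (W p) ((hWsub p hp).trans sdiff_subset) h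
  have hsub : ∀ U, IsComponentOf U (H3 \ M) → ∀ p ∈ Ω, p ∈ idealBoundary U → W p ⊆ U :=
    fun U hU p hp h => hU.subset_of_inter_nonempty (hWsub p hp) (hWc p hp)
      (hWA p hp U (hU.subset.trans sdiff_subset) h)
  have hself : ∀ p ∈ Ω, (W p).Nonempty := fun p hp => by
    simpa using hWne p hp p hp (interior_subset (hWi p hp))
  obtain ⟨p₀, hp₀⟩ := hne
  obtain ⟨x₀, hx₀⟩ := hself p₀ hp₀
  set U := connectedComponentIn (H3 \ M) x₀ with hUdef
  have hU : IsComponentOf U (H3 \ M) := ⟨x₀, hWsub p₀ hp₀ hx₀, rfl⟩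
  have hWU : W p₀ ⊆ U := (hWc p₀ hp₀).subset_connectedComponentIn hx₀ (hWsub p₀ hp₀)
  refine ⟨U, ⟨hU, ?_⟩, ?_⟩
  · by_contra hcon
    obtain ⟨p₁, hp₁, hp₁U⟩ := not_subset.mp hcon
    -- The points of `Ω` adjacent to `U` and the remaining ones would separate `Ω`.
    obtain ⟨q, hqΩ, hqU, hqV⟩ := hΩ (interior (idealBoundary U))
      (⋃ p ∈ Ω \ idealBoundary U, interior (idealBoundary (W p))) isOpen_interior
      (isOpen_biUnion fun _ _ => isOpen_interior) (by
        intro p hp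
        by_cases h : p ∈ idealBoundary U
        · exact Or.inl (interior_mono (idealBoundary_mono (hsub U hU p hp h)) (hWi p hp))
        · exact Or.inr (mem_biUnion (show p ∈ Ω \ idealBoundary U from ⟨hp, h⟩) (hWi p hp)))
      ⟨p₀, hp₀, interior_mono (idealBoundary_mono hWU) (hWi p₀ hp₀)⟩
      ⟨p₁, hp₁, mem_biUnion (show p₁ ∈ Ω \ idealBoundary U from ⟨hp₁, hp₁U⟩) (hWi p₁ hp₁)⟩
    obtain ⟨p, hp, hqp⟩ := mem_iUnion₂.mp hqV
    have h1 := hsub U hU q hqΩ (interior_subset hqU)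
    obtain ⟨x, hx1, hx2⟩ := hWne p hp.1 q hqΩ (interior_subset hqp)
    have h2 := hU.subset_of_inter_nonempty (hWsub p hp.1) (hWc p hp.1) ⟨x, h1 hx2, hx1⟩
    exact hp.2 (idealBoundary_mono h2 (interior_subset (hWi p hp.1)))
  · rintro V ⟨hV, hVΩ⟩
    exact hV.eq_of_inter_nonempty hU ⟨x₀, hsub V hV p₀ hp₀ (hVΩ hp₀) hx₀, hWU hx₀⟩

/-- A connected set in the complement of `M` that accumulates at a point of the ideal boundary of
a component outside the ideal boundary of `M` lies in that component. -/
theorem IsComponentOf.subset_of_mem_idealBoundary {M U B : Set (ℂ × ℝ)} {p : Sphere}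
    (hU : IsComponentOf U (H3 \ M)) (hpM : p ∉ idealBoundary M) (hpU : p ∈ idealBoundary U)
    (hB : B ⊆ H3 \ M) (hBc : IsPreconnected B) (hpB : p ∈ idealBoundary B) : B ⊆ U := by
  obtain ⟨W, hWsub, hWc, hWA, -⟩ := exists_endNeighborhood hpM
  have h1 := hU.subset_of_inter_nonempty hWsub hWc (hWA U (hU.subset.trans sdiff_subset) hpU)
  obtain ⟨x, hxB, hxW⟩ := hWA B (hB.trans sdiff_subset) hpB
  exact hU.subset_of_inter_nonempty hB hBc ⟨x, h1 hxW, hxB⟩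

/-! ### Epstein points and horoballs -/

theorem thresholdTime_nonneg (f : ℂ → Sphere) : 0 ≤ thresholdTime f := by
  refine EReal.mul_nonneg (by exact_mod_cast (by norm_num : (0 : ℝ) ≤ 1 / 2)) ?_
  rw [← ENNReal.log_one]
  exact ENNReal.log_monotone (le_max_left _ _)

/-- The Epstein point lies on the horosphere at `z` whose size is given by the metric. This holds
whatever the derivative of `φ` is. -/
theorem planarEpstein_mem_horosphere (φ : ℂ → ℝ) (z : ℂ) :
    0 < (planarEpstein φ z).2 ∧
    ‖z - (planarEpstein φ z).1‖ ^ 2 + (planarEpstein φ z).2 ^ 2 =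
      2 * Real.exp (-φ z / 2) * (planarEpstein φ z).2 := by
  set d := dbar φ z with hd
  set s := Real.exp (-φ z / 2) with hs
  have hs0 : 0 < s := Real.exp_pos _
  have hss : Real.exp (-φ z) = s ^ 2 := by
    rw [hs, pow_two, ← Real.exp_add]; congr 1; ring
  have hk : 0 < 1 + ‖d‖ ^ 2 * s ^ 2 := by positivity
  have e1 : (planarEpstein φ z).2 = 2 * s / (1 + ‖d‖ ^ 2 * s ^ 2) := by
    rw [planarEpstein, hss]
  have e2 : ‖z - (planarEpstein φ z).1‖ = 2 * ‖d‖ * s ^ 2 / (1 + ‖d‖ ^ 2 * s ^ 2) := by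
    rw [planarEpstein, hss]
    simp only [sub_add_cancel_left, norm_neg, norm_div, norm_mul, Complex.norm_real,
      Complex.norm_ofNat, Real.norm_eq_abs]
    rw [abs_of_pos hk, abs_of_pos (by positivity : 0 < s ^ 2)]
  rw [e1, e2]
  refine ⟨by positivity, ?_⟩
  field_simp
  ring

/-- The open horoball at `f ζ` determined by the hyperbolic metric of the image of `f`. -/
def openHoroball (f : ℂ → Sphere) (ζ : ℂ) : Set (ℂ × ℝ) :=
  {x | x ∈ H3 ∧ 1 < (1 - ‖ζ‖ ^ 2) * horoKernel f x ζ}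

section

variable {f : ℂ → Sphere} {Ω : Set Sphere} {ζ : ℂ}

theorem one_sub_sq_norm_pos (hζ : ζ ∈ disk) : 0 < 1 - ‖ζ‖ ^ 2 := by
  have : ‖ζ‖ < 1 := by simpa [disk] using hζ
  nlinarith [norm_nonneg ζ]

theorem mem_openHoroball_of_ne_infty {z : ℂ} (h : f ζ = (z : Sphere)) (x : ℂ × ℝ) :
    x ∈ openHoroball f ζ ↔ 0 < x.2 ∧ ‖z - x.1‖ ^ 2 + x.2 ^ 2 <
      (1 - ‖ζ‖ ^ 2) * ‖deriv (fun w => affineCoord (f w)) ζ‖ * x.2 := by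
  have hne : f ζ ≠ OnePoint.infty := by rw [h]; exact OnePoint.coe_ne_infty z
  refine and_congr_right fun hx => ?_
  have hx' : 0 < x.2 := hx
  rw [horoKernel_of_ne_infty hne, h, affineCoord_coe, mul_div_assoc', one_lt_div (by positivity)]
  ring_nf

theorem mem_openHoroball_of_eq_infty (h : f ζ = OnePoint.infty) (x : ℂ × ℝ) :
    x ∈ openHoroball f ζ ↔ 0 < x.2 ∧
      1 < (1 - ‖ζ‖ ^ 2) * ‖deriv (fun w => coordAtInfty (f w)) ζ‖ * x.2 := by
  refine and_congr_right fun hx => ?_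
  rw [horoKernel_of_eq_infty h]
  ring_nf

/-- The function of `x` that defines a horoball at `z` is convex in the Euclidean sense. -/
theorem horosphere_comb_le (z : ℂ) (c : ℝ) (x y : ℂ × ℝ) {a b : ℝ} (ha : 0 ≤ a) (hb : 0 ≤ b)
    (hab : a + b = 1) :
    ‖z - (a • x + b • y).1‖ ^ 2 + (a • x + b • y).2 ^ 2 - c * (a • x + b • y).2 ≤
      a * (‖z - x.1‖ ^ 2 + x.2 ^ 2 - c * x.2) + b * (‖z - y.1‖ ^ 2 + y.2 ^ 2 - c * y.2) := by
  obtain rfl : b = 1 - a := by linarith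
  have key : a * (‖z - x.1‖ ^ 2 + x.2 ^ 2 - c * x.2) +
      (1 - a) * (‖z - y.1‖ ^ 2 + y.2 ^ 2 - c * y.2) -
      (‖z - (a • x + (1 - a) • y).1‖ ^ 2 + (a • x + (1 - a) • y).2 ^ 2 -
        c * (a • x + (1 - a) • y).2) = a * (1 - a) * (‖x.1 - y.1‖ ^ 2 + (x.2 - y.2) ^ 2) := by
    simp only [← Complex.normSq_eq_norm_sq, Complex.normSq_apply, Prod.fst_add, Prod.snd_add,
      Prod.smul_fst, Prod.smul_snd, Complex.real_smul, smul_eq_mul, Complex.sub_re, Complex.sub_im,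
      Complex.add_re, Complex.add_im, Complex.re_ofReal_mul, Complex.im_ofReal_mul]
    ring
  have : 0 ≤ a * (1 - a) * (‖x.1 - y.1‖ ^ 2 + (x.2 - y.2) ^ 2) := by positivity
  linarith

namespace IsConformalOnto

theorem convex_openHoroball (hf : IsConformalOnto f Ω) (hζ : ζ ∈ disk) :
    Convex ℝ (openHoroball f ζ) := by
  by_cases h : f ζ = OnePoint.infty
  · set c := (1 - ‖ζ‖ ^ 2) * ‖deriv (fun w => coordAtInfty (f w)) ζ‖ with hc
    have hcpos : 0 < c :=
      mul_pos (one_sub_sq_norm_pos hζ) (norm_pos_iff.mpr (hf.deriv_coordAtInfty_ne_zero hζ h))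
    have : openHoroball f ζ = (ContinuousLinearMap.snd ℝ ℂ ℝ) ⁻¹' Ioi (1 / c) := by
      ext x
      rw [mem_openHoroball_of_eq_infty h, ← hc]
      change _ ↔ 1 / c < x.2
      rw [div_lt_iff₀ hcpos, mul_comm x.2]
      exact ⟨fun h => h.2, fun h => ⟨pos_of_mul_pos_right (zero_lt_one.trans h) hcpos.le, h⟩⟩
    rw [this]
    exact (convex_Ioi _).affine_preimage (ContinuousLinearMap.snd ℝ ℂ ℝ).toLinearMap.toAffineMap
  · obtain ⟨z, hz⟩ : ∃ z : ℂ, f ζ = (z : Sphere) := ⟨_, eq_coe_affineCoord h⟩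
    intro x hx y hy a b ha hb hab
    have hc := convex_H3 hx.1 hy.1 ha hb hab
    rw [mem_openHoroball_of_ne_infty hz] at hx hy ⊢
    refine ⟨hc, ?_⟩
    have := horosphere_comb_le z ((1 - ‖ζ‖ ^ 2) * ‖deriv (fun w => affineCoord (f w)) ζ‖) x y
      ha hb hab
    have h1 := sub_neg.mpr hx.2
    have h2 := sub_neg.mpr hy.2
    rcases ha.eq_or_lt with rfl | ha'
    · obtain rfl : b = 1 := by linarith
      linarith
    · nlinarith [mul_neg_of_pos_of_neg ha' h1, mul_nonpos_of_nonneg_of_nonpos hb h2.le]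

theorem mem_idealBoundary_openHoroball (hf : IsConformalOnto f Ω) (hζ : ζ ∈ disk) :
    f ζ ∈ idealBoundary (openHoroball f ζ) := by
  by_cases h : f ζ = OnePoint.infty
  · set c := (1 - ‖ζ‖ ^ 2) * ‖deriv (fun w => coordAtInfty (f w)) ζ‖ with hc
    have hcpos : 0 < c :=
      mul_pos (one_sub_sq_norm_pos hζ) (norm_pos_iff.mpr (hf.deriv_coordAtInfty_ne_zero hζ h))
    rw [h, mem_idealBoundary_infty]
    intro R
    have hm : 0 < max R (1 / c) + 1 := by
      have : 0 < 1 / c := by positivity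
      have := le_max_right R (1 / c)
      linarith
    refine ⟨(0, max R (1 / c) + 1), ?_, ?_⟩
    · rw [mem_openHoroball_of_eq_infty h, ← hc]
      refine ⟨hm, ?_⟩
      have h1 : 1 / c < max R (1 / c) + 1 := (le_max_right _ _).trans_lt (lt_add_one _)
      rwa [div_lt_iff₀ hcpos, mul_comm] at h1
    · exact ((le_max_left R (1 / c)).trans_lt (lt_add_one _)).trans_le
        ((le_abs_self _).trans (norm_snd_le ((0 : ℂ), max R (1 / c) + 1)))
  · obtain ⟨z, hz⟩ : ∃ z : ℂ, f ζ = (z : Sphere) := ⟨_, eq_coe_affineCoord h⟩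
    set c := (1 - ‖ζ‖ ^ 2) * ‖deriv (fun w => affineCoord (f w)) ζ‖ with hc
    have hcpos : 0 < c :=
      mul_pos (one_sub_sq_norm_pos hζ) (norm_pos_iff.mpr (hf.deriv_affineCoord_ne_zero hζ h))
    rw [hz, mem_idealBoundary_coe, Metric.mem_closure_iff]
    intro ε hε
    have hm : 0 < min (ε / 2) (c / 2) := by positivity
    refine ⟨(z, min (ε / 2) (c / 2)), ?_, ?_⟩
    · rw [mem_openHoroball_of_ne_infty hz, ← hc]
      refine ⟨hm, ?_⟩
      have : min (ε / 2) (c / 2) ≤ c / 2 := min_le_right _ _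
      simp only [sub_self, norm_zero]
      nlinarith
    · rw [Prod.dist_eq]
      simp only [dist_self, Real.dist_eq, zero_sub, abs_neg, abs_of_pos hm]
      exact max_lt hε ((min_le_left _ _).trans_lt (half_lt_self hε))

theorem poincareMetric_apply (hf : IsConformalOnto f Ω) (hζ : ζ ∈ disk) :
    poincareMetric f (f ζ) = diskDensity ζ / roundPullback f ζ := by
  rw [poincareMetric, hf.injOn.leftInvOn_invFunOn hζ]

/-- For `t ≥ 0` the Epstein point of `e^{2t} ρ_Ω` at `f ζ` lies in the closed horoball at `f ζ`
determined by `ρ_Ω`. -/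
theorem epsteinMap_mem_closure_openHoroball (hf : IsConformalOnto f Ω) (hζ : ζ ∈ disk) {t : ℝ}
    (ht : 0 ≤ t) : epsteinMap (fun p => Real.exp (2 * t) * poincareMetric f p) (f ζ) ∈
      closure (openHoroball f ζ) := by
  have hexp : ∀ {c : ℝ}, 0 < c →
      Real.exp (-Real.log ((2 * Real.exp t / c) ^ 2) / 2) = c / (2 * Real.exp t) := by
    intro c hc
    have h1 : -Real.log ((2 * Real.exp t / c) ^ 2) / 2 = -Real.log (2 * Real.exp t / c) := by
      rw [Real.log_pow]; push_cast; ring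
    rw [h1, Real.exp_neg, Real.exp_log (by positivity), inv_div]
  have h2t : Real.exp (2 * t) = Real.exp t ^ 2 := by rw [two_mul, Real.exp_add, pow_two]
  have h1ζ := one_sub_sq_norm_pos hζ
  have het : 1 ≤ Real.exp t := Real.one_le_exp ht
  by_cases h : f ζ = OnePoint.infty
  · set c := (1 - ‖ζ‖ ^ 2) * ‖deriv (fun w => coordAtInfty (f w)) ζ‖ with hc
    have hg := norm_pos_iff.mpr (hf.deriv_coordAtInfty_ne_zero hζ h)
    have hcpos : 0 < c := mul_pos h1ζ hg
    have hP : poincareMetric f OnePoint.infty = (1 / c) ^ 2 := by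
      rw [← h, hf.poincareMetric_apply hζ, diskDensity, roundPullback, localExpr_of_eq_infty h]
      beta_reduce
      rw [h, coordAtInfty_infty, hc]
      simp only [norm_zero]
      field_simp
      norm_num
    rw [h]
    set x := epsteinMap (fun p => Real.exp (2 * t) * poincareMetric f p) OnePoint.infty with hx
    have hx2 : x.2 = Real.exp t / c := by
      set φ : ℂ → ℝ := fun z => Real.log (affineDensity (fun p =>
        Real.exp (2 * t) * poincareMetric f (sphereInv p)) z) with hφ
      have hxφ : x = hypInv (planarEpstein φ 0) := rfl
      have hφ0 : φ 0 = Real.log ((2 * Real.exp t / c) ^ 2) := by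
        have : sphereInv ((0 : ℂ) : Sphere) = OnePoint.infty := if_pos rfl
        rw [hφ]
        simp only [affineDensity, this, hP, norm_zero, h2t]
        congr 1
        field_simp
        norm_num
      obtain ⟨e1, e2⟩ := planarEpstein_mem_horosphere φ 0
      rw [hφ0, hexp hcpos, zero_sub, norm_neg] at e2
      rw [hxφ]
      simp only [hypInv, Prod.smul_snd, smul_eq_mul]
      rw [e2]
      field_simp
    refine mem_closure_of_tendsto (f := fun ε : ℝ => ((x.1, x.2 + ε) : ℂ × ℝ)) (b := 𝓝[>] 0) ?_ ?_
    · have : Continuous fun ε : ℝ => ((x.1, x.2 + ε) : ℂ × ℝ) := by fun_prop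
      have h3 := this.tendsto 0
      simp only [add_zero] at h3
      exact h3.mono_left nhdsWithin_le_nhds
    · filter_upwards [self_mem_nhdsWithin] with ε hε
      have hε' : 0 < ε := hε
      rw [mem_openHoroball_of_eq_infty h, ← hc, hx2]
      refine ⟨by positivity, ?_⟩
      have : c * (Real.exp t / c + ε) = Real.exp t + c * ε := by field_simp
      simp only [this]
      have := mul_pos hcpos hε'
      linarith
  · obtain ⟨z, hz⟩ : ∃ z : ℂ, f ζ = (z : Sphere) := ⟨_, eq_coe_affineCoord h⟩
    set c := (1 - ‖ζ‖ ^ 2) * ‖deriv (fun w => affineCoord (f w)) ζ‖ with hc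
    have hg := norm_pos_iff.mpr (hf.deriv_affineCoord_ne_zero hζ h)
    have hcpos : 0 < c := mul_pos h1ζ hg
    have hP : poincareMetric f (z : Sphere) = (1 / c) ^ 2 * (1 + ‖z‖ ^ 2) ^ 2 := by
      rw [← hz, hf.poincareMetric_apply hζ, diskDensity, roundPullback, localExpr_of_ne_infty h]
      beta_reduce
      rw [hz, affineCoord_coe, hc]
      have : 0 < 1 + ‖z‖ ^ 2 := by positivity
      field_simp
    rw [hz]
    set φ : ℂ → ℝ := fun w => Real.log (affineDensity (fun p =>
        Real.exp (2 * t) * poincareMetric f p) w) with hφ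
    change planarEpstein φ z ∈ _
    have hφz : φ z = Real.log ((2 * Real.exp t / c) ^ 2) := by
      rw [hφ]
      simp only [affineDensity, hP, h2t]
      congr 1
      have : 0 < 1 + ‖z‖ ^ 2 := by positivity
      field_simp
      norm_num
    obtain ⟨e1, e2⟩ := planarEpstein_mem_horosphere φ z
    rw [hφz, hexp hcpos] at e2
    set x := planarEpstein φ z with hx
    have hle : ‖z - x.1‖ ^ 2 + x.2 ^ 2 - c * x.2 ≤ 0 := by
      have h4 : 2 * (c / (2 * Real.exp t)) ≤ c := by
        have : 2 * (c / (2 * Real.exp t)) = c / Real.exp t := by field_simp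
        rw [this]
        exact div_le_self hcpos.le het
      have := mul_le_mul_of_nonneg_right h4 e1.le
      linarith
    -- Move from `x` towards the Euclidean centre of the horoball.
    refine mem_closure_of_tendsto
      (f := fun ε : ℝ => (1 - ε) • x + ε • ((z, c / 2) : ℂ × ℝ)) (b := 𝓝[>] 0) ?_ ?_
    · have : Continuous fun ε : ℝ => (1 - ε) • x + ε • ((z, c / 2) : ℂ × ℝ) := by fun_prop
      have h3 := this.tendsto 0
      simp only [sub_zero, one_smul, zero_smul, add_zero] at h3
      exact h3.mono_left nhdsWithin_le_nhds
    · filter_upwards [Ioo_mem_nhdsGT (zero_lt_one' ℝ)] with ε hε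
      rw [mem_openHoroball_of_ne_infty hz, ← hc]
      refine ⟨convex_H3 (show x ∈ H3 from e1) (show ((z, c / 2) : ℂ × ℝ) ∈ H3 from half_pos hcpos)
        (sub_nonneg.mpr hε.2.le) hε.1.le (by ring), ?_⟩
      have h5 := horosphere_comb_le z c x (z, c / 2) (sub_nonneg.mpr hε.2.le) hε.1.le (by ring)
      simp only [sub_self, norm_zero] at h5
      have h6 : (1 - ε) * (‖z - x.1‖ ^ 2 + x.2 ^ 2 - c * x.2) ≤ 0 :=
        mul_nonpos_of_nonneg_of_nonpos (sub_nonneg.mpr hε.2.le) hle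
      have h7 : 0 < ε * (c ^ 2 / 4) := mul_pos hε.1 (by positivity)
      nlinarith

end IsConformalOnto

end

end EpsteinSurface

open EpsteinSurface
theorem mainTheorem10
    (γ : Set Sphere) (hγ : IsJordanCurve γ)
    (Ω : Set Sphere) (hΩ : IsComponentOf Ω γᶜ)
    (f : ℂ → Sphere) (hf : IsConformalOnto f Ω)
    {S : Type*} [TopologicalSpace S] [T2Space S] [SecondCountableTopology S]
    [ChartedSpace Plane S] [IsManifold (𝓡 2) ∞ S]
    (F : S → ℂ × ℝ) (hF : IsProperMinimalImmersion F)
    (M : Set (ℂ × ℝ)) (hM : M = Set.range F)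
    (hMγ : idealBoundary M = γ) :
    (∃! U : Set (ℂ × ℝ), IsComponentOf U (H3 \ M) ∧ Ω ⊆ idealBoundary U) ∧
    ∀ U : Set (ℂ × ℝ), IsComponentOf U (H3 \ M) → Ω ⊆ idealBoundary U →
      ∀ t : ℝ, thresholdTime f ≤ (t : EReal) → equidistantSurface f Ω t ⊆ closure U := by
  have hΩM : ∀ p ∈ Ω, p ∉ idealBoundary M := fun p hp => by
    rw [hMγ]; exact hΩ.subset hp
  have hΩc : IsPreconnected Ω := by
    obtain ⟨x, -, rfl⟩ := hΩ
    exact isPreconnected_connectedComponentIn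
  refine ⟨existsUnique_component hΩc hΩ.nonempty hΩM, ?_⟩
  intro U hU hΩU t ht
  have ht0 : 0 ≤ t := by exact_mod_cast (thresholdTime_nonneg f).trans ht
  rintro _ ⟨p, hp, rfl⟩
  obtain ⟨ζ, hζ, rfl⟩ : p ∈ f '' disk := by rwa [hf.image_eq]
  have hdisj : openHoroball f ζ ⊆ H3 \ M := by
    rintro x ⟨hxH, hx⟩
    refine ⟨hxH, fun hxM => ?_⟩
    rw [hM] at hxM
    obtain ⟨s, rfl⟩ := hxM
    exact absurd (horoKernel_mul_le_one hf hF (by rwa [← hM]) hζ s) (not_le.mpr hx)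
  have hBU : openHoroball f ζ ⊆ U := hU.subset_of_mem_idealBoundary (hΩM _ hp) (hΩU hp) hdisj
    (hf.convex_openHoroball hζ).isPreconnected (hf.mem_idealBoundary_openHoroball hζ)
  exact closure_mono hBU (hf.epsteinMap_mem_closure_openHoroball hζ ht0)
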